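/- Let $q_0>0$, $\alpha,\theta_+,\theta_-\in\mathbb{R}$ with $\theta_++\theta_-=\pi$, put $q_\pm(t)=q_0e^{i(\alpha t+\theta_\pm)}$, let $q:\mathbb{R}^2\to\mathbb{C}$ and fix $t\in\mathbb{R}$. Let $$J=\begin{pmatrix}-1&0\\0&1\end{pmatrix},\quad Q(x)=\begin{pmatrix}0&q(x,t)\\q(-x,-t)&0\end{pmatrix},\quad Q_\pm=\begin{pmatrix}0&q_\pm(t)\\q_\mp(-t)&0\end{pmatrix}.$$ Let $\mathbb{K}=\{(k,\lambda)\in\mathbb{C}^2:\lambda^2=k^2+q_0^2\}$ be the Riemann surface of $\lambda=\sqrt{k^2+q_0^2}$, consisting of two copies (sheets) of the plane cut along $\Sigma=[-iq_0,iq_0]$. On sheet I, $\lambda(k)=(r_1r_2)^{1/2}e^{i(\vartheta_1+\vartheta_2)/2}$, where $k\mp iq_0=r_{1,2}e^{i\vartheta_{1,2}}$ with $-\pi/2\le\vartheta_{1,2}<3\pi/2$. Let $\mathbb{K}^{+}$ and $\mathbb{K}^-$ be the parts of sheet I over $\{\Im k>0\}\setminus\Sigma$ and $\{\Im k<0\}\setminus\Sigma$.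 Closures and boundaries are taken in $\mathbb{K}$; thus $\partial\mathbb{K}^{\pm}$ consists of the real axis of sheet I, both edges of the upper (respectively lower) half of the cut, and $\pm iq_0$, and $\lambda$ is real on it. Consider solutions (locally absolutely continuous in $x\in\mathbb{R}$) of $v_x=(ikJ+Q(x))v$ with the asymptotics $$\phi\sim\begin{pmatrix}\lambda+k\\ iq_+(-t)\end{pmatrix}e^{-i\lambda x},\quad \overline\phi\sim\begin{pmatrix}-iq_-(t)\\ \lambda+k\end{pmatrix}e^{i\lambda x}\quad(x\to-\infty),$$ $$\psi\sim\begin{pmatrix}-iq_+(t)\\ \lambda+k\end{pmatrix}e^{i\lambda x},\quad \overline\psi\sim\begin{pmatrix}\lambda+k\\ iq_-(-t)\end{pmatrix}e^{-i\lambda x}\quad(x\to+\infty),$$ where $v\sim c\,e^{i\mu x}$ means $e^{-i\mu x}v\to c$, and put $M=e^{i\lambda x}\phi$, $\overline M=e^{-i\lambda x}\overline\phi$, $N=e^{-i\lambda x}\psi$, $\overline N=e^{i\lambda x}\overline\psi$. (The bars are part of the names and do not denote complex conjugation.) Theorem. Suppose that the entries of $Q-Q_+$ on $[0,\infty)$ and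 of $Q-Q_-$ on $(-\infty,0]$ are of class $L^{1,1}$, i.e. measurable with $\int|f(x)|(1+|x|)\,dx<\infty$ over the half-line in question. Then $\phi$ and $\psi$ exist and are unique at every point of $\overline{\mathbb{K}^+}\cup\partial\mathbb{K}^-$, and $\overline\phi$ and $\overline\psi$ exist and are unique at every point of $\overline{\mathbb{K}^-}\cup\partial\mathbb{K}^+$. Moreover, for each $x\in\mathbb{R}$: $M(x,\cdot)$ and $N(x,\cdot)$ are continuous on $\overline{\mathbb{K}^+}\cup\partial\mathbb{K}^-$ and analytic in $k$ on $\mathbb{K}^+$; $\overline M(x,\cdot)$ and $\overline N(x,\cdot)$ are continuous on $\overline{\mathbb{K}^-}\cup\partial\mathbb{K}^+$ and analytic in $k$ on $\mathbb{K}^-$. -/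

import Mathlib

open Filter Topology MeasureTheory

namespace NonlocalSinhGordon

noncomputable section

/-! ### The Riemann surface of `λ = √(k² + q₀²)` -/

/-- The Riemann surface `𝕂`: pairs `(k, λ)` with `λ² = k² + q₀²`, with the subspace topology
of `ℂ × ℂ`. (For `q₀ > 0` this is two copies of the plane cut along `[-i q₀, i q₀]`, glued so
that `λ` is continuous through the cut; over each inner point of the cut lie the two edges,
which carry opposite values of `λ`.) -/
abbrev Surface (q₀ : ℝ) : Type := {p : ℂ × ℂ // p.2 ^ 2 = p.1 ^ 2 + (q₀ : ℂ) ^ 2}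

/-- The spectral parameter `k` of a point of the surface. -/
def Surface.k {q₀ : ℝ} (p : Surface q₀) : ℂ := p.1.1

/-- The value of `λ` at a point of the surface. -/
def Surface.lam {q₀ : ℝ} (p : Surface q₀) : ℂ := p.1.2

/-- The polar angle normalised to `[-π/2, 3π/2)`. -/
def angle (z : ℂ) : ℝ :=
  if z.arg < -(Real.pi / 2) then z.arg + 2 * Real.pi else z.arg

/-- The branch of `λ` on sheet I: `λ(k) = (r₁ r₂)^{1/2} e^{i(θ₁+θ₂)/2}`, where
`k - i q₀ = r₁ e^{iθ₁}` and `k + i q₀ = r₂ e^{iθ₂}` with `θ₁, θ₂ ∈ [-π/2, 3π/2)`. -/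
def lamI (q₀ : ℝ) (k : ℂ) : ℂ :=
  (Real.sqrt (‖k - Complex.I * q₀‖ * ‖k + Complex.I * q₀‖) : ℂ) *
    Complex.exp (Complex.I *
      (((angle (k - Complex.I * q₀) + angle (k + Complex.I * q₀)) / 2 : ℝ) : ℂ))

theorem norm_mul_exp_angle (z : ℂ) :
    (‖z‖ : ℂ) * Complex.exp (Complex.I * (angle z : ℂ)) = z := by
  have h := Complex.norm_mul_exp_arg_mul_I z
  unfold angle
  split_ifs
  · have e : Complex.I * ((z.arg + 2 * Real.pi : ℝ) : ℂ)
        = z.arg * Complex.I + 2 * Real.pi * Complex.I := by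
      push_cast; ring
    rw [e, Complex.exp_add, Complex.exp_two_pi_mul_I, mul_one, h]
  · rw [mul_comm Complex.I, h]

theorem lamI_sq (q₀ : ℝ) (k : ℂ) : lamI q₀ k ^ 2 = k ^ 2 + (q₀ : ℂ) ^ 2 := by
  have h1 := norm_mul_exp_angle (k - Complex.I * q₀)
  have h2 := norm_mul_exp_angle (k + Complex.I * q₀)
  have hs : ((Real.sqrt (‖k - Complex.I * q₀‖ * ‖k + Complex.I * q₀‖) : ℝ) : ℂ) ^ 2
      = (‖k - Complex.I * q₀‖ : ℂ) * (‖k + Complex.I * q₀‖ : ℂ) := by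
    rw [← Complex.ofReal_pow, Real.sq_sqrt (by positivity), Complex.ofReal_mul]
  have he : Complex.exp (Complex.I *
      (((angle (k - Complex.I * q₀) + angle (k + Complex.I * q₀)) / 2 : ℝ) : ℂ)) ^ 2
      = Complex.exp (Complex.I * (angle (k - Complex.I * q₀) : ℂ)) *
        Complex.exp (Complex.I * (angle (k + Complex.I * q₀) : ℂ)) := by
    rw [← Complex.exp_nat_mul, ← Complex.exp_add]
    congr 1
    push_cast
    ring
  calc lamI q₀ k ^ 2
      = ((‖k - Complex.I * q₀‖ : ℂ) *
          Complex.exp (Complex.I * (angle (k - Complex.I * q₀) : ℂ))) *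
        ((‖k + Complex.I * q₀‖ : ℂ) *
          Complex.exp (Complex.I * (angle (k + Complex.I * q₀) : ℂ))) := by
        unfold lamI
        rw [mul_pow, hs, he]
        ring
    _ = (k - Complex.I * q₀) * (k + Complex.I * q₀) := by rw [h1, h2]
    _ = k ^ 2 + (q₀ : ℂ) ^ 2 := by
        linear_combination (-(q₀ : ℂ) ^ 2) * Complex.I_sq

/-- The point of sheet I over `k`. -/
def sheetI (q₀ : ℝ) (k : ℂ) : Surface q₀ := ⟨(k, lamI q₀ k), lamI_sq q₀ k⟩

/-- The cut `Σ = [-i q₀, i q₀]`. -/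
def cut (q₀ : ℝ) : Set ℂ := {k | k.re = 0 ∧ |k.im| ≤ q₀}

/-- The open upper half plane cut along `Σ`. -/
def upperCut (q₀ : ℝ) : Set ℂ := {k | 0 < k.im} \ cut q₀

/-- The open lower half plane cut along `Σ`. -/
def lowerCut (q₀ : ℝ) : Set ℂ := {k | k.im < 0} \ cut q₀

/-- `𝕂⁺` as a region of the Riemann surface (on sheet I). -/
def Kplus (q₀ : ℝ) : Set (Surface q₀) := sheetI q₀ '' upperCut q₀

/-- `𝕂⁻` as a region of the Riemann surface (on sheet I). -/
def Kminus (q₀ : ℝ) : Set (Surface q₀) := sheetI q₀ '' lowerCut q₀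

/-! ### The scattering problem -/

/-- The background value `q_±(t) = q₀ e^{i(α t + θ_±)}` (with `θ = θ_±`). -/
def qInf (q₀ α θ t : ℝ) : ℂ := q₀ * Complex.exp (Complex.I * ((α * t + θ : ℝ) : ℂ))

/-- `J = diag(-1, 1)`. -/
def J : Matrix (Fin 2) (Fin 2) ℂ := !![-1, 0; 0, 1]

/-- The potential matrix `Q`, with off-diagonal entries `q(x,t)` and `q(-x,-t)`. -/
def Q (q : ℝ → ℝ → ℂ) (t x : ℝ) : Matrix (Fin 2) (Fin 2) ℂ :=
  !![0, q x t; q (-x) (-t), 0]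

/-- `Q₊(t)`, the limit of `Q` as `x → +∞`. -/
def Qplus (q₀ α θp θm t : ℝ) : Matrix (Fin 2) (Fin 2) ℂ :=
  !![0, qInf q₀ α θp t; qInf q₀ α θm (-t), 0]

/-- `Q₋(t)`, the limit of `Q` as `x → -∞`. -/
def Qminus (q₀ α θp θm t : ℝ) : Matrix (Fin 2) (Fin 2) ℂ :=
  !![0, qInf q₀ α θm t; qInf q₀ α θp (-t), 0]

/-- `f` is measurable on `s` and `∫_s |f(x)| (1 + |x|) dx < ∞`. For `s = ℝ` this is the
space `L^{1,1}(ℝ)`. -/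
def MemL11 (s : Set ℝ) (f : ℝ → ℂ) : Prop :=
  AEStronglyMeasurable f (volume.restrict s) ∧
    IntegrableOn (fun x : ℝ => ‖f x‖ * (1 + |x|)) s

/-- `v` is a (locally absolutely continuous) solution on `ℝ` of `v_x = (i k J + V(x)) v`,
the equation being written in its integrated form. -/
def IsSolution (V : ℝ → Matrix (Fin 2) (Fin 2) ℂ) (k : ℂ) (v : ℝ → Fin 2 → ℂ) : Prop :=
  Continuous v ∧ ∀ a b : ℝ,
    IntervalIntegrable (fun s => ((Complex.I * k) • J + V s).mulVec (v s)) volume a b ∧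
      v b - v a = ∫ s in a..b, ((Complex.I * k) • J + V s).mulVec (v s)

/-- `v` is a solution with `v(x) ∼ c e^{i μ x}` along the filter `l` (which is `x → -∞` or
`x → +∞`), that is, `e^{-i μ x} v(x) → c`. -/
def IsJost (V : ℝ → Matrix (Fin 2) (Fin 2) ℂ) (k μ : ℂ) (l : Filter ℝ) (c : Fin 2 → ℂ)
    (v : ℝ → Fin 2 → ℂ) : Prop :=
  IsSolution V k v ∧
    Tendsto (fun x : ℝ => Complex.exp (-(Complex.I * μ * x)) • v x) l (𝓝 c)

variable (q₀ α θp θm : ℝ) (q : ℝ → ℝ → ℂ) (t : ℝ) (p : Surface q₀)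

/-- `φ ∼ w e^{-iλx}` as `x → -∞`, with `w = (λ + k, i q₊)`. Here `q₊` is the lower left entry
of `Q₋(t)`. -/
def IsPhi : (ℝ → Fin 2 → ℂ) → Prop :=
  IsJost (Q q t) p.k (-p.lam) atBot ![p.lam + p.k, Complex.I * qInf q₀ α θp (-t)]

/-- `φ̄ ∼ w̄ e^{iλx}` as `x → -∞`, with `w̄ = (-i q₋, λ + k)`. Here `q₋` is the upper right
entry of `Q₋(t)`. -/
def IsPhiBar : (ℝ → Fin 2 → ℂ) → Prop :=
  IsJost (Q q t) p.k p.lam atBot ![-(Complex.I * qInf q₀ α θm t), p.lam + p.k]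

/-- `ψ ∼ v e^{iλx}` as `x → +∞`, with `v = (-i q₊, λ + k)`. Here `q₊` is the upper right
entry of `Q₊(t)`. -/
def IsPsi : (ℝ → Fin 2 → ℂ) → Prop :=
  IsJost (Q q t) p.k p.lam atTop ![-(Complex.I * qInf q₀ α θp t), p.lam + p.k]

/-- `ψ̄ ∼ v̄ e^{-iλx}` as `x → +∞`, with `v̄ = (λ + k, i q₋)`. Here `q₋` is the lower left
entry of `Q₊(t)`. -/
def IsPsiBar : (ℝ → Fin 2 → ℂ) → Prop :=
  IsJost (Q q t) p.k (-p.lam) atTop ![p.lam + p.k, Complex.I * qInf q₀ α θm (-t)]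

/-- `M(x, ·) = e^{iλx} φ(x, ·)`, where `φ` is the eigenfunction with the prescribed asymptotics
(arbitrary at points of the surface where there is none or more than one). -/
def M (x : ℝ) : Fin 2 → ℂ :=
  Complex.exp (Complex.I * p.lam * x) • Classical.epsilon (IsPhi q₀ α θp q t p) x

/-- `M̄(x, ·) = e^{-iλx} φ̄(x, ·)`. -/
def MBar (x : ℝ) : Fin 2 → ℂ :=
  Complex.exp (-(Complex.I * p.lam * x)) • Classical.epsilon (IsPhiBar q₀ α θm q t p) x

/-- `N(x, ·) = e^{-iλx} ψ(x, ·)`. -/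
def N (x : ℝ) : Fin 2 → ℂ :=
  Complex.exp (-(Complex.I * p.lam * x)) • Classical.epsilon (IsPsi q₀ α θp q t p) x

/-- `N̄(x, ·) = e^{iλx} ψ̄(x, ·)`. -/
def NBar (x : ℝ) : Fin 2 → ℂ :=
  Complex.exp (Complex.I * p.lam * x) • Classical.epsilon (IsPsiBar q₀ α θm q t p) x

end

end NonlocalSinhGordon

open NonlocalSinhGordon

/-! Write `A = i k J + V₀` for the constant matrix at the relevant end and `D = V - V₀`, and look
for a solution `v = e^{iμx} m` near `-∞` with `m → c`. Then `m' = N m + D m` with `N = A - iμ`.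
Since `q_+ q_- = -q₀²` at opposite times, `A² = -λ² = -μ²`, so `N² = ν N` with `ν = -2iμ`, and `N c
= 0`. Hence `e^{sN} = 1 + expInt ν s • N` and `m(x) = c + ∫_{-∞}^x e^{(x-y)N} D(y) m(y) dy`.

Two facts drive the proof. The function `expInt` is entire in `ν`, so nothing is divided by `λ` and
the branch points need no separate treatment. If `Re ν ≤ 0`, that is `Im μ ≤ 0`, then `|expInt ν s|
≤ s` for `s ≥ 0`; the kernel grows at most linearly in `x - y`, which the weight `1 + |y|` absorbs.
The Neumann series is therefore dominated by an exponential series, locally uniformly in the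
parameter, so its sum is continuous (`continuousOn_jostSol`) and holomorphic
(`differentiableOn_jostSol`) in the parameter whenever `k`, `μ` and `c` are. Variation of constants
(`isPrimitive_of_integral_eq`) shows that the sum solves the differential equation.

Uniqueness (`IsJost.unique`) uses the Wronskian, which is constant because the trace vanishes; the
normalisation forces it to be zero for a Jost solution and the difference of two. The end `+∞` is
reduced to `-∞` by `x ↦ -x`, which turns `(V, k, μ)` into `(-V(-·), -k, -μ)`.

Finally, the sets of the theorem enter only through the sign of `Im λ`: `Kplus_eq` and `Kminus_eq`
describe the regions by the signs of `Im k` and `Im λ`, so that `Im λ` has a weak sign on the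
closures and vanishes on the boundaries. -/

namespace NonlocalSinhGordon

/-! ### Indefinite integrals of locally integrable vector-valued functions -/

section Primitive

variable {E : Type*} [NormedAddCommGroup E] [NormedSpace ℝ E]

/-- `f` is locally integrable and `F` is an indefinite integral of `f`. -/
def IsPrimitive (F f : ℝ → E) : Prop :=
  ∀ a b : ℝ, IntervalIntegrable f volume a b ∧ F b - F a = ∫ s in a..b, f s

/-- Increments of the integral are bounded by those of the integral of `‖f‖`, which reduces the
claim to the scalar case. -/
theorem absolutelyContinuousOnInterval_intervalIntegral {f : ℝ → E} {a b c : ℝ}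
    (hf : ∀ a b : ℝ, IntervalIntegrable f volume a b) :
    AbsolutelyContinuousOnInterval (fun x => ∫ s in c..x, f s) a b := by
  have hf' : ∀ a b : ℝ, IntervalIntegrable (fun s => ‖f s‖) volume a b := fun a b => (hf a b).norm
  have h := (hf' a b).absolutelyContinuousOnInterval_intervalIntegral (c := a) (by simp)
  rw [absolutelyContinuousOnInterval_iff] at h ⊢
  intro ε hε
  obtain ⟨δ, hδ, H⟩ := h ε hε
  refine ⟨δ, hδ, fun I hI hI' => lt_of_le_of_lt ?_ (H I hI hI')⟩
  refine Finset.sum_le_sum fun i _ => ?_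
  rw [dist_eq_norm, Real.dist_eq, intervalIntegral.integral_interval_sub_left (hf _ _) (hf _ _),
    intervalIntegral.integral_interval_sub_left (hf' _ _) (hf' _ _)]
  exact intervalIntegral.norm_integral_le_abs_integral_norm

variable {F f : ℝ → E}

theorem IsPrimitive.congr_right {g : ℝ → E} (h : IsPrimitive F f) (hfg : ∀ x, f x = g x) :
    IsPrimitive F g := by
  rwa [← funext hfg]

theorem IsPrimitive.eq_add (h : IsPrimitive F f) (a : ℝ) :
    F = fun x => F a + ∫ s in a..x, f s := by
  funext x
  rw [← (h a x).2]
  abel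

theorem IsPrimitive.continuous (h : IsPrimitive F f) : Continuous F := by
  rw [h.eq_add 0]
  exact continuous_const.add (intervalIntegral.continuous_primitive (fun a b => (h a b).1) 0)

theorem IsPrimitive.absolutelyContinuousOnInterval (h : IsPrimitive F f) (a b : ℝ) :
    AbsolutelyContinuousOnInterval F a b := by
  have h0 : AbsolutelyContinuousOnInterval (fun _ : ℝ => F 0) a b :=
    (LipschitzWith.const (F 0)).lipschitzOnWith.absolutelyContinuousOnInterval
  rw [h.eq_add 0]
  exact h0.fun_add (absolutelyContinuousOnInterval_intervalIntegral fun a b => (h a b).1)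

theorem IsPrimitive.ae_hasDerivAt [CompleteSpace E] (h : IsPrimitive F f) :
    ∀ᵐ x, HasDerivAt F (f x) x := by
  have hl : LocallyIntegrable f volume := by
    intro x
    refine ⟨Set.Icc (x - 1) (x + 1), Icc_mem_nhds (by linarith) (by linarith), ?_⟩
    rw [← intervalIntegrable_iff_integrableOn_Icc_of_le (by linarith)]
    exact (h _ _).1
  filter_upwards [LocallyIntegrable.ae_hasDerivAt_integral hl] with x hx
  have := (hx 0).const_add (F 0)
  rwa [← h.eq_add 0] at this

/-- The difference of `F` and the integral of `f` is absolutely continuous with derivative zero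
almost everywhere, hence constant. This gives the product rule below for coefficients that are only
integrable. -/
theorem isPrimitive_of_ae_hasDerivAt [CompleteSpace E]
    (hF : ∀ a b, AbsolutelyContinuousOnInterval F a b)
    (hf : ∀ a b : ℝ, IntervalIntegrable f volume a b) (h : ∀ᵐ x, HasDerivAt F (f x) x) :
    IsPrimitive F f := by
  intro a b
  refine ⟨hf a b, ?_⟩
  have hp : IsPrimitive (fun x => ∫ s in a..x, f s) f := fun c d =>
    ⟨hf c d, intervalIntegral.integral_interval_sub_left (hf _ _) (hf _ _)⟩
  obtain ⟨C, hC⟩ := ((hF a b).fun_sub (hp.absolutelyContinuousOnInterval a b)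
    ).const_of_ae_hasDerivAt_zero (by
      filter_upwards [h, hp.ae_hasDerivAt] with x h1 h2 _
      have := h1.fun_sub h2
      rwa [sub_self] at this)
  have h1 := hC a (by simp)
  have h2 := hC b (by simp)
  simp only [intervalIntegral.integral_same, sub_zero] at h1
  rw [h1, ← h2]
  abel

theorem isPrimitive_of_hasDerivAt [CompleteSpace E] (h : ∀ x, HasDerivAt F (f x) x)
    (hf : Continuous f) : IsPrimitive F f := fun a b =>
  ⟨hf.intervalIntegrable a b,
    (intervalIntegral.integral_eq_sub_of_hasDerivAt (fun x _ => h x)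
      (hf.intervalIntegrable a b)).symm⟩

theorem IsPrimitive.add {G g : ℝ → E} (hF : IsPrimitive F f) (hG : IsPrimitive G g) :
    IsPrimitive (fun x => F x + G x) (fun x => f x + g x) := fun a b =>
  ⟨(hF a b).1.add (hG a b).1, by
    rw [intervalIntegral.integral_add (hF a b).1 (hG a b).1, ← (hF a b).2, ← (hG a b).2]
    exact add_sub_add_comm _ _ _ _⟩

theorem IsPrimitive.sub {G g : ℝ → E} (hF : IsPrimitive F f) (hG : IsPrimitive G g) :
    IsPrimitive (fun x => F x - G x) (fun x => f x - g x) := fun a b =>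
  ⟨(hF a b).1.sub (hG a b).1, by
    rw [intervalIntegral.integral_sub (hF a b).1 (hG a b).1, ← (hF a b).2, ← (hG a b).2]
    exact sub_sub_sub_comm _ _ _ _⟩

theorem IsPrimitive.const_add (hF : IsPrimitive F f) (c : E) :
    IsPrimitive (fun x => c + F x) f := fun a b =>
  ⟨(hF a b).1, by rw [← (hF a b).2]; exact add_sub_add_left_eq_sub _ _ _⟩

theorem IsPrimitive.comp_clm [CompleteSpace E] {E' : Type*} [NormedAddCommGroup E']
    [NormedSpace ℝ E'] [CompleteSpace E'] (hF : IsPrimitive F f) (T : E →L[ℝ] E') :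
    IsPrimitive (fun x => T (F x)) (fun x => T (f x)) := fun a b =>
  ⟨⟨T.integrable_comp (hF a b).1.1, T.integrable_comp (hF a b).1.2⟩, by
    rw [T.intervalIntegral_comp_comm (hF a b).1, ← (hF a b).2, map_sub]⟩

theorem IsPrimitive.comp_neg (hF : IsPrimitive F f) :
    IsPrimitive (fun x => F (-x)) (fun x => -f (-x)) := by
  intro a b
  have h := (hF (-b) (-a))
  refine ⟨?_, ?_⟩
  · have := ((hF (-a) (-b)).1.comp_sub_left 0).neg
    simpa using! this
  · rw [intervalIntegral.integral_neg, intervalIntegral.integral_comp_neg, ← h.2]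
    abel

theorem IsPrimitive.smul {𝕜 : Type*} [RCLike 𝕜] [NormedSpace 𝕜 E] [IsScalarTower ℝ 𝕜 E]
    [CompleteSpace E] {u u' : ℝ → 𝕜} (hu : IsPrimitive u u') (hF : IsPrimitive F f) :
    IsPrimitive (fun x => u x • F x) (fun x => u' x • F x + u x • f x) := by
  refine isPrimitive_of_ae_hasDerivAt (fun a b => (hu.absolutelyContinuousOnInterval a b).fun_smul
    (hF.absolutelyContinuousOnInterval a b)) (fun a b => ?_) ?_
  · exact ((hu a b).1.smul_continuousOn hF.continuous.continuousOn).add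
      ((hF a b).1.continuousOn_smul hu.continuous.continuousOn)
  · filter_upwards [hu.ae_hasDerivAt, hF.ae_hasDerivAt] with x h1 h2
    have := h1.smul h2
    rwa [add_comm] at this

theorem IsPrimitive.pow_succ {B β : ℝ → ℝ} (h : IsPrimitive B β) (n : ℕ) :
    IsPrimitive (fun x => B x ^ (n + 1)) (fun x => (n + 1) * (β x * B x ^ n)) := by
  induction n with
  | zero => simpa using h
  | succ n ih =>
    have := h.smul ih
    convert this using 2 with x x
    · simp only [smul_eq_mul]; ring
    · simp only [smul_eq_mul]; push_cast; ring

end Primitive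

/-! ### Uniqueness for linear equations with locally integrable coefficients -/

section Gronwall

variable {E : Type*} [NormedAddCommGroup E] [NormedSpace ℝ E]

/-- Feeding a bound back into the integral equation improves it: with `B = ∫_a β`, the bound `C
Bⁿ/n!` becomes `C Bⁿ⁺¹/(n+1)!`, and these tend to zero. -/
theorem eq_zero_of_isPrimitive_of_norm_le_of_le {v f : ℝ → E} {β : ℝ → ℝ} (hv : IsPrimitive v f)
    (hβ : ∀ a b : ℝ, IntervalIntegrable β volume a b) (hβ0 : ∀ x, 0 ≤ β x)
    (hf : ∀ x, ‖f x‖ ≤ β x * ‖v x‖) {a x : ℝ} (ha : v a = 0) (hx : a ≤ x) : v x = 0 := by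
  have hB : IsPrimitive (fun y => ∫ s in a..y, β s) β := fun c d =>
    ⟨hβ c d, intervalIntegral.integral_interval_sub_left (hβ _ _) (hβ _ _)⟩
  set B : ℝ → ℝ := fun y => ∫ s in a..y, β s with hBdef
  obtain ⟨C, hC⟩ := (isCompact_Icc (a := a) (b := x)).exists_bound_of_continuousOn
    hv.continuous.continuousOn
  have key : ∀ n : ℕ, ∀ y ∈ Set.Icc a x, ‖v y‖ ≤ C * (B y ^ n / n.factorial) := by
    intro n
    induction n with
    | zero => intro y hy; simpa using hC y hy
    | succ n ih =>
      intro y hy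
      have h1 : v y = ∫ s in a..y, f s := by rw [← (hv a y).2, ha, sub_zero]
      have hp := hB.pow_succ n a y
      have hBa : B a = 0 := by simp [hBdef]
      have hi : IntervalIntegrable (fun s => C / (n + 1).factorial * ((n + 1) * (β s * B s ^ n)))
        volume a y := hp.1.const_mul _
      rw [h1]
      calc ‖∫ s in a..y, f s‖
          ≤ ∫ s in a..y, C / (n + 1).factorial * ((n + 1) * (β s * B s ^ n)) := by
            refine intervalIntegral.norm_integral_le_of_norm_le hy.1 ?_ hi
            refine Eventually.of_forall fun s hs => (hf s).trans ?_
            have h2 := ih s ⟨hs.1.le, hs.2.trans hy.2⟩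
            calc β s * ‖v s‖ ≤ β s * (C * (B s ^ n / n.factorial)) :=
                  mul_le_mul_of_nonneg_left h2 (hβ0 s)
              _ = _ := by
                rw [Nat.factorial_succ]; push_cast
                field_simp
        _ = C * (B y ^ (n + 1) / (n + 1).factorial) := by
            rw [intervalIntegral.integral_const_mul, ← hp.2]
            simp only [hBa, ne_eq, Nat.succ_ne_zero, not_false_eq_true, zero_pow, sub_zero]
            ring
  have hlim : Tendsto (fun n : ℕ => C * (B x ^ n / n.factorial)) atTop (𝓝 0) := by
    simpa using (FloorSemiring.tendsto_pow_div_factorial_atTop (B x)).const_mul C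
  exact norm_le_zero_iff.1 (ge_of_tendsto' hlim fun n => key n x ⟨hx, le_rfl⟩)

theorem eq_zero_of_isPrimitive_of_norm_le {v f : ℝ → E} {β : ℝ → ℝ} (hv : IsPrimitive v f)
    (hβ : ∀ a b : ℝ, IntervalIntegrable β volume a b) (hβ0 : ∀ x, 0 ≤ β x)
    (hf : ∀ x, ‖f x‖ ≤ β x * ‖v x‖) {a : ℝ} (ha : v a = 0) (x : ℝ) : v x = 0 := by
  rcases le_total a x with h | h
  · exact eq_zero_of_isPrimitive_of_norm_le_of_le hv hβ hβ0 hf ha h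
  · have hβ' : ∀ a b : ℝ, IntervalIntegrable (fun s => β (-s)) volume a b := fun a b => by
      simpa using (hβ (-a) (-b)).comp_sub_left 0
    have := eq_zero_of_isPrimitive_of_norm_le_of_le hv.comp_neg hβ' (fun s => hβ0 _)
      (fun s => by simpa using hf (-s)) (a := -a) (x := -x) (by simpa using ha) (by linarith)
    simpa using this

end Gronwall

/-! ### Left tails of an integrable majorant -/

section Mass

/-- The mass of `β` on `(-∞, x]`. -/
noncomputable def massIic (β : ℝ → ℝ) (x : ℝ) : ℝ := ∫ y in Set.Iic x, β y

variable {β : ℝ → ℝ}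

theorem isPrimitive_integral_Iic {E : Type*} [NormedAddCommGroup E] [NormedSpace ℝ E] {f : ℝ → E}
    (hf : ∀ x, IntegrableOn f (Set.Iic x)) : IsPrimitive (fun x => ∫ y in Set.Iic x, f y) f :=
  fun a b => by
    refine ⟨?_, intervalIntegral.integral_Iic_sub_Iic (hf a) (hf b)⟩
    rw [intervalIntegrable_iff]
    exact (hf (max a b)).mono_set fun y hy => hy.2

theorem tendsto_integral_Iic_atBot {E : Type*} [NormedAddCommGroup E] [NormedSpace ℝ E]
    {f : ℝ → E} (hf : ∀ x, IntegrableOn f (Set.Iic x)) :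
    Tendsto (fun x => ∫ y in Set.Iic x, f y) atBot (𝓝 0) := by
  have h := intervalIntegral_tendsto_integral_Iic 0 (hf 0) tendsto_id
  have h2 := h.const_sub (∫ y in Set.Iic 0, f y)
  rw [sub_self] at h2
  refine h2.congr fun x => ?_
  rw [id, ← intervalIntegral.integral_Iic_sub_Iic (hf x) (hf 0)]
  abel

theorem isPrimitive_massIic (hβ : Integrable β) : IsPrimitive (massIic β) β :=
  isPrimitive_integral_Iic fun _ => hβ.integrableOn

theorem massIic_nonneg (h0 : ∀ y, 0 ≤ β y) (x : ℝ) : 0 ≤ massIic β x :=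
  integral_nonneg fun y => h0 y

theorem massIic_mono (hβ : Integrable β) (h0 : ∀ y, 0 ≤ β y) : Monotone (massIic β) :=
  fun _ _ hxy => setIntegral_mono_set hβ.integrableOn (Eventually.of_forall h0)
    (Set.Iic_subset_Iic.2 hxy).eventuallyLE

theorem integrableOn_mul_massIic_pow (hβ : Integrable β) (h0 : ∀ y, 0 ≤ β y) (n : ℕ) (x : ℝ) :
    IntegrableOn (fun y => β y * massIic β y ^ n) (Set.Iic x) := by
  refine Integrable.mono' (hβ.integrableOn.mul_const (massIic β x ^ n))
    (hβ.aestronglyMeasurable.restrict.mul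
      ((isPrimitive_massIic hβ).continuous.pow n).aestronglyMeasurable) ?_
  filter_upwards [ae_restrict_mem measurableSet_Iic] with y hy
  rw [Real.norm_eq_abs, abs_of_nonneg (mul_nonneg (h0 y) (pow_nonneg (massIic_nonneg h0 y) n))]
  exact mul_le_mul_of_nonneg_left
    (pow_le_pow_left₀ (massIic_nonneg h0 y) (massIic_mono hβ h0 hy) n) (h0 y)

/-- The power rule on `[a, x]` with `a → -∞`, where the mass vanishes. The factor `1/(n+1)` is what
produces the factorials in the Neumann series. -/
theorem integral_mul_massIic_pow (hβ : Integrable β) (h0 : ∀ y, 0 ≤ β y) (n : ℕ) (x : ℝ) :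
    ∫ y in Set.Iic x, β y * massIic β y ^ n = massIic β x ^ (n + 1) / (n + 1) := by
  have hp := (isPrimitive_massIic hβ).pow_succ n
  have h1 := intervalIntegral_tendsto_integral_Iic x (integrableOn_mul_massIic_pow hβ h0 n x)
    tendsto_id
  have h2 : Tendsto (fun a => (massIic β x ^ (n + 1) - massIic β a ^ (n + 1)) / (n + 1)) atBot
      (𝓝 (massIic β x ^ (n + 1) / (n + 1))) := by
    have := (((tendsto_integral_Iic_atBot (f := β) fun _ => hβ.integrableOn).pow
      (n + 1)).const_sub (massIic β x ^ (n + 1))).div_const ((n : ℝ) + 1)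
    simpa [massIic] using this
  refine tendsto_nhds_unique h1 (h2.congr fun a => ?_)
  rw [(hp a x).2, intervalIntegral.integral_const_mul]
  field_simp
  rfl

end Mass

/-! ### Volterra equations from `-∞` with a parameter -/

section Volterra

variable {Λ E : Type*} [NormedAddCommGroup E] [NormedSpace ℂ E]

/-- The successive approximations `mₙ₊₁(x) = ∫_{-∞}^x κ(x, y) mₙ(y) dy`, `m₀ = c`, depending on a
parameter. -/
noncomputable def volterraIter (κ : Λ → ℝ → ℝ → E →L[ℂ] E) (c : Λ → E) : ℕ → Λ → ℝ → E
  | 0 => fun p _ => c p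
  | n + 1 => fun p x => ∫ y in Set.Iic x, κ p x y (volterraIter κ c n p y)

/-- The solution of `m(x) = c + ∫_{-∞}^x κ(x, y) m(y) dy` as a Neumann series. -/
noncomputable def volterraSol (κ : Λ → ℝ → ℝ → E →L[ℂ] E) (c : Λ → E) (p : Λ) (x : ℝ) : E :=
  ∑' n, volterraIter κ c n p x

/-- Kernels and initial values for which the Neumann series converges, uniformly for parameters
in `S`. -/
structure VolterraData [TopologicalSpace Λ] (κ : Λ → ℝ → ℝ → E →L[ℂ] E) (c : Λ → E) (S : Set Λ)
    (β : ℝ → ℝ → ℝ) (C : ℝ) : Prop where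
  integrable : ∀ X, Integrable (β X)
  nonneg : ∀ X y, 0 ≤ β X y
  norm_le : ∀ p ∈ S, ∀ X x y, y ≤ x → x ≤ X → ‖κ p x y‖ ≤ β X y
  cont : ∀ y, ContinuousOn (fun z : Λ × ℝ => κ z.1 z.2 y) (S ×ˢ Set.univ)
  meas : ∀ p ∈ S, ∀ x, AEStronglyMeasurable (κ p x) volume
  cont_init : ContinuousOn c S
  norm_init_le : ∀ p ∈ S, ‖c p‖ ≤ C
  bound_nonneg : 0 ≤ C

namespace VolterraData

variable [TopologicalSpace Λ] {κ : Λ → ℝ → ℝ → E →L[ℂ] E} {c : Λ → E} {S : Set Λ}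
  {β : ℝ → ℝ → ℝ} {C : ℝ}

theorem continuous_right (_h : VolterraData κ c S β C) {m : Λ → ℝ → E}
    (hm : ContinuousOn (fun z : Λ × ℝ => m z.1 z.2) (S ×ˢ Set.univ)) {p : Λ} (hp : p ∈ S) :
    Continuous (m p) := by
  have : ContinuousOn (fun x : ℝ => m p x) Set.univ :=
    hm.comp (f := fun x : ℝ => (p, x)) (by fun_prop) fun x _ => ⟨hp, Set.mem_univ _⟩
  simpa using this

theorem aestronglyMeasurable_apply (h : VolterraData κ c S β C) {m : ℝ → E} (hm : Continuous m)
    {p : Λ} (hp : p ∈ S) (x : ℝ) (s : Set ℝ) :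
    AEStronglyMeasurable (fun y => κ p x y (m y)) (volume.restrict s) :=
  (ContinuousLinearMap.id ℂ (E →L[ℂ] E)).aestronglyMeasurable_comp₂ (h.meas p hp x).restrict
    hm.aestronglyMeasurable

theorem norm_apply_le (h : VolterraData κ c S β C) {p : Λ} (hp : p ∈ S) {X x y K : ℝ} {v : E}
    (hyx : y ≤ x) (hx : x ≤ X) (hv : ‖v‖ ≤ K) : ‖κ p x y v‖ ≤ β X y * K :=
  (ContinuousLinearMap.le_opNorm _ _).trans
    (mul_le_mul (h.norm_le p hp X x y hyx hx) hv (norm_nonneg _) (h.nonneg X y))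

/-- Dominated convergence, jointly in the parameter and the endpoint; the moving domain is moved
into an indicator, and the majorant for the endpoint bound `x₀ + 1` serves all nearby endpoints. -/
theorem continuousOn_integral [FirstCountableTopology Λ] (h : VolterraData κ c S β C)
    {m : Λ → ℝ → E} (hm : ContinuousOn (fun z : Λ × ℝ => m z.1 z.2) (S ×ˢ Set.univ))
    {K : ℝ → ℝ} (hK : ∀ X, ∀ p ∈ S, ∀ y ≤ X, ‖m p y‖ ≤ K X) :
    ContinuousOn (fun z : Λ × ℝ => ∫ y in Set.Iic z.2, κ z.1 z.2 y (m z.1 y))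
      (S ×ˢ Set.univ) := by
  rintro ⟨p₀, x₀⟩ ⟨hp₀ : p₀ ∈ S, -⟩
  simp_rw [← integral_indicator measurableSet_Iic]
  have hX : ∀ᶠ z : Λ × ℝ in 𝓝[S ×ˢ Set.univ] (p₀, x₀), z.1 ∈ S ∧ z.2 ≤ x₀ + 1 := by
    have h1 : ∀ᶠ z : Λ × ℝ in 𝓝[S ×ˢ Set.univ] (p₀, x₀), z ∈ S ×ˢ (Set.univ : Set ℝ) :=
      self_mem_nhdsWithin
    have h2 : ∀ᶠ z : Λ × ℝ in 𝓝[S ×ˢ Set.univ] (p₀, x₀), z.2 < x₀ + 1 :=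
      mem_nhdsWithin_of_mem_nhds ((continuous_snd.continuousAt (x := (p₀, x₀))).eventually_lt_const
        (by simp))
    filter_upwards [h1, h2] with z hz hz' using ⟨hz.1, hz'.le⟩
  refine continuousWithinAt_of_dominated
    (bound := fun y => β (x₀ + 1) y * K (x₀ + 1)) ?_ ?_ ((h.integrable _).mul_const _) ?_
  · filter_upwards [hX] with z hz
    rw [aestronglyMeasurable_indicator_iff measurableSet_Iic]
    exact h.aestronglyMeasurable_apply (h.continuous_right hm hz.1) hz.1 _ _
  · filter_upwards [hX] with z hz
    refine Eventually.of_forall fun y => ?_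
    by_cases hy : y ∈ Set.Iic z.2
    · rw [Set.indicator_of_mem hy]
      exact h.norm_apply_le hz.1 hy hz.2 (hK _ _ hz.1 _ (le_trans hy hz.2))
    · rw [Set.indicator_of_notMem hy, norm_zero]
      exact mul_nonneg (h.nonneg _ _)
        ((norm_nonneg _).trans (hK (x₀ + 1) p₀ hp₀ (x₀ + 1) le_rfl))
  -- The indicator may jump at `y = x₀`; away from this null set it is locally constant in the
  -- endpoint.
  · have hne : ∀ᵐ y : ℝ, y ≠ x₀ := by simp [ae_iff]
    filter_upwards [hne] with y hy
    have hc : ContinuousWithinAt (fun z : Λ × ℝ => κ z.1 z.2 y (m z.1 y)) (S ×ˢ Set.univ)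
        (p₀, x₀) := by
      have h1 := h.cont y (p₀, x₀) ⟨hp₀, Set.mem_univ _⟩
      have h2 : ContinuousOn (fun z : Λ × ℝ => m z.1 y) (S ×ˢ Set.univ) :=
        hm.comp (f := fun z : Λ × ℝ => (z.1, y)) (by fun_prop)
          fun z hz => ⟨hz.1, Set.mem_univ _⟩
      exact h1.clm_apply (h2 _ ⟨hp₀, Set.mem_univ _⟩)
    rcases lt_or_gt_of_ne hy with hlt | hgt
    · refine hc.congr_of_eventuallyEq ?_ ?_
      · have : ∀ᶠ z : Λ × ℝ in 𝓝[S ×ˢ Set.univ] (p₀, x₀), y < z.2 :=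
          mem_nhdsWithin_of_mem_nhds
            ((continuous_snd.continuousAt (x := (p₀, x₀))).eventually_const_lt hlt)
        filter_upwards [this] with z hz
        exact Set.indicator_of_mem (show y ∈ Set.Iic z.2 from hz.le) _
      · exact Set.indicator_of_mem (show y ∈ Set.Iic x₀ from hlt.le) _
    · refine (continuousWithinAt_const (b := (0 : E))).congr_of_eventuallyEq ?_ ?_
      · have : ∀ᶠ z : Λ × ℝ in 𝓝[S ×ˢ Set.univ] (p₀, x₀), z.2 < y :=
          mem_nhdsWithin_of_mem_nhds
            ((continuous_snd.continuousAt (x := (p₀, x₀))).eventually_lt_const hgt)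
        filter_upwards [this] with z hz
        exact Set.indicator_of_notMem (show y ∉ Set.Iic z.2 from not_le.2 hz) _
      · exact Set.indicator_of_notMem (show y ∉ Set.Iic x₀ from not_le.2 hgt) _

/-- The two claims are proved together, since continuity of the next iterate needs the bound on the
previous one for domination. -/
theorem continuousOn_iter_and_norm_iter_le [FirstCountableTopology Λ]
    (h : VolterraData κ c S β C) (n : ℕ) :
    ContinuousOn (fun z : Λ × ℝ => volterraIter κ c n z.1 z.2) (S ×ˢ Set.univ) ∧
      ∀ X, ∀ p ∈ S, ∀ x ≤ X,
        ‖volterraIter κ c n p x‖ ≤ C * (massIic (β X) x ^ n / n.factorial) := by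
  induction n with
  | zero =>
    refine ⟨h.cont_init.comp continuousOn_fst fun z hz => hz.1, fun X p hp x _ => ?_⟩
    simpa [volterraIter] using h.norm_init_le p hp
  | succ n ih =>
    refine ⟨h.continuousOn_integral ih.1
      (K := fun X => C * (massIic (β X) X ^ n / n.factorial)) fun X p hp y hy => ?_,
      fun X p hp x hx => ?_⟩
    · refine (ih.2 X p hp y hy).trans ?_
      have h1 := massIic_mono (h.integrable X) (h.nonneg X) hy
      have h2 := massIic_nonneg (h.nonneg X) y
      have h3 := h.bound_nonneg
      gcongr
    · have hi := (integrableOn_mul_massIic_pow (h.integrable X) (h.nonneg X) n x).const_mul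
        (C / n.factorial)
      calc ‖volterraIter κ c (n + 1) p x‖
          ≤ ∫ y in Set.Iic x, C / n.factorial * (β X y * massIic (β X) y ^ n) := by
            refine norm_integral_le_of_norm_le hi ?_
            filter_upwards [ae_restrict_mem measurableSet_Iic] with y hy
            refine (h.norm_apply_le hp hy hx (ih.2 X p hp y (le_trans hy hx))).trans_eq ?_
            ring
        _ = C * (massIic (β X) x ^ (n + 1) / (n + 1).factorial) := by
            rw [integral_const_mul, integral_mul_massIic_pow (h.integrable X) (h.nonneg X),
              Nat.factorial_succ]
            push_cast
            field_simp

theorem norm_iter_le [FirstCountableTopology Λ] (h : VolterraData κ c S β C) (n : ℕ) {X : ℝ}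
    {p : Λ} (hp : p ∈ S) {x : ℝ} (hx : x ≤ X) :
    ‖volterraIter κ c n p x‖ ≤ C * (massIic (β X) X ^ n / n.factorial) := by
  refine ((h.continuousOn_iter_and_norm_iter_le n).2 X p hp x hx).trans ?_
  have h1 := massIic_mono (h.integrable X) (h.nonneg X) hx
  have h2 := massIic_nonneg (h.nonneg X) x
  have h3 := h.bound_nonneg
  gcongr

theorem hasSum_bound (C B : ℝ) :
    HasSum (fun n : ℕ => C * (B ^ n / n.factorial)) (C * Real.exp B) := by
  rw [Real.exp_eq_exp_ℝ]
  exact (NormedSpace.expSeries_div_hasSum_exp B).mul_left C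

theorem norm_sol_le [FirstCountableTopology Λ] (h : VolterraData κ c S β C) {X : ℝ} {p : Λ}
    (hp : p ∈ S) {x : ℝ} (hx : x ≤ X) :
    ‖volterraSol κ c p x‖ ≤ C * Real.exp (massIic (β X) X) :=
  tsum_of_norm_bounded (hasSum_bound C _) fun n => h.norm_iter_le n hp hx

variable [CompleteSpace E]

theorem continuousOn_sol [FirstCountableTopology Λ] (h : VolterraData κ c S β C) :
    ContinuousOn (fun z : Λ × ℝ => volterraSol κ c z.1 z.2) (S ×ˢ Set.univ) := by
  rintro ⟨p₀, x₀⟩ ⟨hp₀, -⟩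
  -- The Weierstrass bound is uniform only for `x` bounded above, hence the restriction to a
  -- half-line around `x₀`.
  have h1 : ContinuousOn (fun z : Λ × ℝ => volterraSol κ c z.1 z.2) (S ×ˢ Set.Iio (x₀ + 1)) :=
    continuousOn_tsum
      (fun n => (h.continuousOn_iter_and_norm_iter_le n).1.mono
        (Set.prod_mono subset_rfl (Set.subset_univ _)))
      (hasSum_bound C (massIic (β (x₀ + 1)) (x₀ + 1))).summable
      fun n z hz => h.norm_iter_le n hz.1 (le_of_lt hz.2)
  refine (h1 (p₀, x₀) ⟨hp₀, by simp⟩).mono_of_mem_nhdsWithin ?_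
  rw [nhdsWithin_prod_eq, nhdsWithin_univ]
  exact prod_mem_prod self_mem_nhdsWithin (Iio_mem_nhds (by simp))

theorem sol_eq [FirstCountableTopology Λ] (h : VolterraData κ c S β C) {p : Λ} (hp : p ∈ S)
    (x : ℝ) :
    volterraSol κ c p x = c p + ∫ y in Set.Iic x, κ p x y (volterraSol κ c p y) := by
  have hs := fun {y : ℝ} (hy : y ≤ x) =>
    (Summable.of_norm_bounded (hasSum_bound C (massIic (β x) x)).summable
      fun n => h.norm_iter_le n hp hy).hasSum
  have h1 : HasSum (fun n => volterraIter κ c (n + 1) p x)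
      (∫ y in Set.Iic x, κ p x y (volterraSol κ c p y)) := by
    refine hasSum_integral_of_dominated_convergence
      (fun n y => β x y * (C * (massIic (β x) x ^ n / n.factorial))) (fun n => ?_) (fun n => ?_)
      (Eventually.of_forall fun y => (hasSum_bound C _).summable.mul_left _) ?_ ?_
    · exact h.aestronglyMeasurable_apply
        (h.continuous_right (h.continuousOn_iter_and_norm_iter_le n).1 hp) hp _ _
    · filter_upwards [ae_restrict_mem measurableSet_Iic] with y hy
      exact h.norm_apply_le hp hy le_rfl (h.norm_iter_le n hp hy)
    · simp_rw [tsum_mul_left]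
      exact (h.integrable x).integrableOn.mul_const _
    · filter_upwards [ae_restrict_mem measurableSet_Iic] with y hy
      exact (κ p x y).hasSum (hs hy)
  rw [← h1.tsum_eq]
  exact (hs le_rfl).summable.tsum_eq_zero_add

end VolterraData

end Volterra

/-! ### Holomorphic dependence on the parameter -/

section Holomorphic

variable {E : Type*} [NormedAddCommGroup E] [NormedSpace ℂ E]

/-- No bound on the derivative of the integrand is assumed: Cauchy's estimate on circles of radius
`r / 4` supplies one from the bound on the integrand itself. -/
theorem differentiableOn_integral_of_norm_le [CompleteSpace E] {α : Type*} [MeasurableSpace α]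
    {μ : Measure α} {U : Set ℂ} (hU : IsOpen U) {F : ℂ → α → E} {g : α → ℝ}
    (hF : ∀ z ∈ U, AEStronglyMeasurable (F z) μ) (hg : Integrable g μ)
    (hFg : ∀ᵐ a ∂μ, ∀ z ∈ U, ‖F z a‖ ≤ g a)
    (hd : ∀ᵐ a ∂μ, DifferentiableOn ℂ (fun z => F z a) U) :
    DifferentiableOn ℂ (fun z => ∫ a, F z a ∂μ) U := by
  intro z₀ hz₀
  obtain ⟨r, hr, hrU⟩ := Metric.isOpen_iff.1 hU z₀ hz₀
  have hr2 : 0 < r / 2 := by linarith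
  have hsub : ∀ z ∈ Metric.ball z₀ (r / 2), Metric.closedBall z (r / 4) ⊆ U := by
    intro z hz w hw
    apply hrU
    rw [Metric.mem_ball] at hz ⊢
    rw [Metric.mem_closedBall] at hw
    linarith [dist_triangle w z z₀]
  have hmem : ∀ z ∈ Metric.ball z₀ (r / 2), z ∈ U := fun z hz =>
    hsub z hz (Metric.mem_closedBall_self (by linarith))
  refine ((hasDerivAt_integral_of_dominated_loc_of_deriv_le (μ := μ) (F := F)
    (F' := fun z a => deriv (fun w => F w a) z) (bound := fun a => g a / (r / 4))
    (Metric.ball_mem_nhds z₀ hr2) ?_ ?_ ?_ ?_ (hg.div_const _)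
    ?_).2).differentiableAt.differentiableWithinAt
  · filter_upwards [hU.mem_nhds hz₀] with z hz using hF z hz
  · exact hg.mono' (hF z₀ hz₀) (hFg.mono fun a ha => ha z₀ hz₀)
  -- The derivative is measurable in `a` as a limit of difference quotients along this sequence,
  -- which keeps `z₀ + u n` in the ball.
  · let u : ℕ → ℂ := fun n => ((r / 2 / (n + 1) : ℝ) : ℂ)
    have hu0 : ∀ n, u n ≠ 0 := fun n => by
      rw [Complex.ofReal_ne_zero]
      positivity
    have hu : Tendsto u atTop (𝓝[≠] 0) := by
      refine tendsto_nhdsWithin_iff.2 ⟨?_, Eventually.of_forall hu0⟩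
      have h1 : Tendsto (fun n : ℕ => r / 2 / ((n : ℝ) + 1)) atTop (𝓝 0) := by
        have := (tendsto_one_div_add_atTop_nhds_zero_nat (𝕜 := ℝ)).const_mul (r / 2)
        simpa [div_eq_mul_inv] using this
      rw [← Complex.ofReal_zero]
      exact (Complex.continuous_ofReal.tendsto 0).comp h1
    have huU : ∀ n, z₀ + u n ∈ U := fun n => hrU (by
      rw [Metric.mem_ball, dist_eq_norm, add_sub_cancel_left, Complex.norm_real, Real.norm_eq_abs,
        abs_of_pos (by positivity)]
      have : r / 2 / ((n : ℝ) + 1) ≤ r / 2 :=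
        div_le_self hr2.le (by linarith [n.cast_nonneg (α := ℝ)])
      linarith)
    refine aestronglyMeasurable_of_tendsto_ae (u := atTop)
      (f := fun n a => (u n)⁻¹ • (F (z₀ + u n) a - F z₀ a))
      (fun n => ((hF _ (huU n)).sub (hF _ hz₀)).const_smul _) ?_
    filter_upwards [hd] with a ha
    exact ((ha.differentiableAt (hU.mem_nhds hz₀)).hasDerivAt.tendsto_slope_zero).comp hu
  · filter_upwards [hFg, hd] with a ha hda z hz
    refine Complex.norm_deriv_le_of_forall_mem_sphere_norm_le (by linarith)
      (hda.diffContOnCl_ball (hsub z hz)) fun w hw =>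
        ha w (hsub z hz (Metric.sphere_subset_closedBall hw))
  · filter_upwards [hd] with a hda z hz
    exact (hda.differentiableAt (hU.mem_nhds (hmem z hz))).hasDerivAt

namespace VolterraData

variable [CompleteSpace E] {κ : ℂ → ℝ → ℝ → E →L[ℂ] E} {c : ℂ → E} {U : Set ℂ}
  {β : ℝ → ℝ → ℝ} {C : ℝ}

theorem differentiableOn_iter (h : VolterraData κ c U β C) (hU : IsOpen U)
    (hκ : ∀ x y, DifferentiableOn ℂ (fun z => κ z x y) U) (hc : DifferentiableOn ℂ c U) (n : ℕ) :
    ∀ x, DifferentiableOn ℂ (fun z => volterraIter κ c n z x) U := by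
  induction n with
  | zero => exact fun x => hc
  | succ n ih =>
    intro x
    refine differentiableOn_integral_of_norm_le hU (fun z hz => ?_)
      ((h.integrable x).integrableOn.mul_const (C * (massIic (β x) x ^ n / n.factorial))) ?_ ?_
    · exact h.aestronglyMeasurable_apply
        (h.continuous_right (h.continuousOn_iter_and_norm_iter_le n).1 hz) hz _ _
    · filter_upwards [ae_restrict_mem measurableSet_Iic] with y hy z hz
      exact h.norm_apply_le hz hy le_rfl (h.norm_iter_le n hz hy)
    · exact Eventually.of_forall fun y => (hκ x y).clm_apply (ih y)

theorem differentiableOn_sol (h : VolterraData κ c U β C) (hU : IsOpen U)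
    (hκ : ∀ x y, DifferentiableOn ℂ (fun z => κ z x y) U) (hc : DifferentiableOn ℂ c U) (x : ℝ) :
    DifferentiableOn ℂ (fun z => volterraSol κ c z x) U :=
  Complex.differentiableOn_tsum_of_summable_norm (hasSum_bound C (massIic (β x) x)).summable
    (fun n => h.differentiableOn_iter hU hκ hc n x) hU fun n _ hz => h.norm_iter_le n hz le_rfl

end VolterraData

end Holomorphic

/-! ### The function `(e^{νs} - 1)/ν` with its singularity at `ν = 0` removed -/

section ExpInt

/-- `∫₀ˢ e^{ντ} dτ`, as an entire function of `ν`. -/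
noncomputable def expInt (ν : ℂ) (s : ℝ) : ℂ := s * dslope Complex.exp 0 (ν * s)

theorem differentiable_dslope_exp : Differentiable ℂ (dslope Complex.exp 0) := by
  rw [← differentiableOn_univ, Complex.differentiableOn_dslope univ_mem]
  exact Complex.differentiable_exp.differentiableOn

theorem continuous_expInt : Continuous (fun z : ℂ × ℝ => expInt z.1 z.2) := by
  have := differentiable_dslope_exp.continuous
  unfold expInt
  fun_prop

theorem differentiable_expInt (s : ℝ) : Differentiable ℂ (fun ν => expInt ν s) := by
  unfold expInt
  exact (differentiable_dslope_exp.comp (differentiable_id.mul_const _)).const_mul _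

@[simp]
theorem expInt_zero_right (ν : ℂ) : expInt ν 0 = 0 := by simp [expInt]

theorem one_add_mul_expInt (ν : ℂ) (s : ℝ) : 1 + ν * expInt ν s = Complex.exp (ν * s) := by
  have h := sub_smul_dslope Complex.exp 0 (ν * s)
  rw [sub_zero, Complex.exp_zero, smul_eq_mul] at h
  unfold expInt
  linear_combination h

theorem hasDerivAt_expInt (ν : ℂ) (s : ℝ) :
    HasDerivAt (expInt ν) (Complex.exp (ν * s)) s := by
  rcases eq_or_ne ν 0 with rfl | hν
  · have : expInt 0 = fun s : ℝ => (s : ℂ) := by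
      funext s
      simp [expInt, dslope_same]
    rw [this]
    simpa using (hasDerivAt_id s).ofReal_comp
  · have : expInt ν = fun s : ℝ => ν⁻¹ * (Complex.exp (ν * s) - 1) := by
      funext s
      rw [← one_add_mul_expInt]
      field_simp
      ring
    rw [this]
    have h1 : HasDerivAt (fun s : ℝ => ν * (s : ℂ)) ν s := by
      simpa using ((hasDerivAt_id s).ofReal_comp).const_mul ν
    have h2 := ((h1.cexp).sub_const 1).const_mul ν⁻¹
    rw [mul_left_comm, inv_mul_cancel₀ hν, mul_one] at h2
    exact h2

theorem norm_exp_mul_le_one {ν : ℂ} (hν : ν.re ≤ 0) {s : ℝ} (hs : 0 ≤ s) :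
    ‖Complex.exp (ν * s)‖ ≤ 1 := by
  rw [Complex.norm_exp, Real.exp_le_one_iff]
  simpa using mul_nonpos_of_nonpos_of_nonneg hν hs

/-- The derivative `e^{νs}` has modulus at most one on `s ≥ 0`. The constant does not depend on `ν`,
so the estimate survives `ν → 0`. -/
theorem norm_expInt_sub_le {ν : ℂ} (hν : ν.re ≤ 0) {a b : ℝ} (ha : 0 ≤ a) (hb : 0 ≤ b) :
    ‖expInt ν b - expInt ν a‖ ≤ |b - a| := by
  have := (convex_Ici (0 : ℝ)).norm_image_sub_le_of_norm_hasDerivWithin_le (C := 1)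
    (fun s _ => (hasDerivAt_expInt ν s).hasDerivWithinAt)
    (fun s hs => norm_exp_mul_le_one hν hs) ha hb
  simpa using this

theorem norm_expInt_le {ν : ℂ} (hν : ν.re ≤ 0) {s : ℝ} (hs : 0 ≤ s) : ‖expInt ν s‖ ≤ s := by
  simpa [abs_of_nonneg hs] using norm_expInt_sub_le hν le_rfl hs

end ExpInt

/-! ### Variation of constants from `-∞` -/

section JostIntegral

theorem integrableOn_of_weight {G : Type*} [NormedAddCommGroup G] {f : ℝ → G} {s : Set ℝ}
    (hm : AEStronglyMeasurable f volume)
    (hf : IntegrableOn (fun y => ‖f y‖ * (1 + |y|)) s) : IntegrableOn f s :=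
  hf.mono' hm.restrict (Eventually.of_forall fun y =>
    le_mul_of_one_le_right (norm_nonneg _) (by linarith [abs_nonneg y]))

variable {E : Type*} [NormedAddCommGroup E] [NormedSpace ℂ E]

theorem integrableOn_expInt_smul {f : ℝ → E} (hm : AEStronglyMeasurable f volume) {x : ℝ}
    (hf : IntegrableOn (fun y => ‖f y‖ * (1 + |y|)) (Set.Iic x)) {ν : ℂ} (hν : ν.re ≤ 0) :
    IntegrableOn (fun y => expInt ν (x - y) • f y) (Set.Iic x) := by
  refine (hf.const_mul (1 + |x|)).mono' (AEStronglyMeasurable.smul (Continuous.aestronglyMeasurable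
    (continuous_expInt.comp (f := fun y : ℝ => (ν, x - y)) (by fun_prop))) hm.restrict) ?_
  filter_upwards [ae_restrict_mem measurableSet_Iic] with y hy
  rw [norm_smul]
  have h1 := norm_expInt_le hν (sub_nonneg.2 hy)
  have h2 : x - y ≤ (1 + |x|) * (1 + |y|) := by
    nlinarith [le_abs_self x, neg_abs_le y, abs_nonneg x, abs_nonneg y,
      mul_nonneg (abs_nonneg x) (abs_nonneg y)]
  calc ‖expInt ν (x - y)‖ * ‖f y‖ ≤ ((1 + |x|) * (1 + |y|)) * ‖f y‖ :=
        mul_le_mul_of_nonneg_right (h1.trans h2) (norm_nonneg _)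
    _ = _ := by ring

/-- There is no boundary term because `expInt ν 0 = 0`. Extending the kernel by zero through `max (x
- y) 0` gives a fixed domain and a function of `x` with Lipschitz constant `‖f y‖`, so one may
differentiate under the integral. -/
theorem hasDerivAt_integral_expInt_smul [CompleteSpace E] {f : ℝ → E}
    (hm : AEStronglyMeasurable f volume)
    (hf : ∀ x, IntegrableOn (fun y => ‖f y‖ * (1 + |y|)) (Set.Iic x)) {ν : ℂ} (hν : ν.re ≤ 0)
    (x₀ : ℝ) :
    HasDerivAt (fun x => ∫ y in Set.Iic x, expInt ν (x - y) • f y)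
      (∫ y in Set.Iic x₀, Complex.exp (ν * ((x₀ - y : ℝ) : ℂ)) • f y) x₀ := by
  set μ := volume.restrict (Set.Iic (x₀ + 1)) with hμ
  have hmeas : ∀ x, AEStronglyMeasurable (fun y => expInt ν (max (x - y) 0) • f y) μ := fun x =>
    AEStronglyMeasurable.smul (Continuous.aestronglyMeasurable
      (continuous_expInt.comp (f := fun y : ℝ => (ν, max (x - y) 0)) (by fun_prop))) hm.restrict
  have hext : ∀ x ≤ x₀ + 1, ∀ g : ℝ → E,
      ∫ y in Set.Iic x, g y = ∫ y, (Set.Iic x).indicator g y ∂μ := fun x hx g => by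
    rw [integral_indicator measurableSet_Iic, hμ, Measure.restrict_restrict measurableSet_Iic,
      Set.inter_eq_left.2 (Set.Iic_subset_Iic.2 hx)]
  have hH : ∀ x ≤ x₀ + 1, ∫ y in Set.Iic x, expInt ν (x - y) • f y
      = ∫ y, expInt ν (max (x - y) 0) • f y ∂μ := fun x hx => by
    rw [hext x hx]
    congr 1
    funext y
    by_cases hy : y ≤ x
    · rw [Set.indicator_of_mem (show y ∈ Set.Iic x from hy), max_eq_left (sub_nonneg.2 hy)]
    · rw [Set.indicator_of_notMem (show y ∉ Set.Iic x from hy),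
        max_eq_right (by linarith [not_le.1 hy]), expInt_zero_right, zero_smul]
  have key := (hasDerivAt_integral_of_dominated_loc_of_lip (μ := μ) (𝕜 := ℝ)
    (F := fun x y => expInt ν (max (x - y) 0) • f y) (x₀ := x₀) (s := Set.univ)
    (F' := (Set.Iic x₀).indicator fun y => Complex.exp (ν * ((x₀ - y : ℝ) : ℂ)) • f y)
    (bound := fun y => ‖f y‖) univ_mem (Eventually.of_forall hmeas) ?_ ?_ ?_ ?_ ?_).2
  · rw [hext x₀ (by linarith)]
    refine key.congr_of_eventuallyEq ?_
    filter_upwards [Iic_mem_nhds (show x₀ < x₀ + 1 by linarith)] with x hx using hH x hx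
  · refine Integrable.mono' ((IntegrableOn.integrable_indicator ((hf x₀).const_mul (1 + |x₀|))
      measurableSet_Iic).integrableOn) (hmeas x₀) (Eventually.of_forall fun y => ?_)
    by_cases hy : y ≤ x₀
    · rw [Set.indicator_of_mem (show y ∈ Set.Iic x₀ from hy), norm_smul]
      have h1 := norm_expInt_le hν (le_max_right (x₀ - y) 0)
      rw [max_eq_left (sub_nonneg.2 hy)] at h1 ⊢
      have h2 : x₀ - y ≤ (1 + |x₀|) * (1 + |y|) := by
        nlinarith [le_abs_self x₀, neg_abs_le y, abs_nonneg x₀, abs_nonneg y,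
          mul_nonneg (abs_nonneg x₀) (abs_nonneg y)]
      calc ‖expInt ν (x₀ - y)‖ * ‖f y‖ ≤ ((1 + |x₀|) * (1 + |y|)) * ‖f y‖ :=
            mul_le_mul_of_nonneg_right (h1.trans h2) (norm_nonneg _)
        _ = _ := by ring
    · rw [Set.indicator_of_notMem (show y ∉ Set.Iic x₀ from hy),
        max_eq_right (by linarith [not_le.1 hy]), expInt_zero_right, zero_smul, norm_zero]
  · exact (AEStronglyMeasurable.smul (Continuous.aestronglyMeasurable (by fun_prop))
      hm.restrict).indicator measurableSet_Iic
  · refine Eventually.of_forall fun y => LipschitzOnWith.of_dist_le_mul fun a _ b _ => ?_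
    rw [dist_eq_norm, ← sub_smul, norm_smul, Real.coe_nnabs, abs_of_nonneg (norm_nonneg _),
      mul_comm, Real.dist_eq]
    refine mul_le_mul_of_nonneg_left ?_ (norm_nonneg _)
    refine (norm_expInt_sub_le hν (le_max_right _ _) (le_max_right _ _)).trans ?_
    refine (abs_max_sub_max_le_abs _ _ _).trans_eq ?_
    congr 1
    ring
  · exact (integrableOn_of_weight hm (hf _)).norm
  · have hne : ∀ᵐ y ∂μ, y ≠ x₀ := ae_restrict_of_ae (by simp [ae_iff])
    filter_upwards [hne] with y hy
    rcases lt_or_gt_of_ne hy with hlt | hgt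
    · rw [Set.indicator_of_mem (show y ∈ Set.Iic x₀ from hlt.le)]
      have h1 : HasDerivAt (fun x => expInt ν (x - y)) (Complex.exp (ν * ((x₀ - y : ℝ) : ℂ))) x₀ :=
        (hasDerivAt_expInt ν (x₀ - y)).comp_sub_const x₀ y
      refine (h1.smul_const (f y)).congr_of_eventuallyEq ?_
      filter_upwards [Ioi_mem_nhds hlt] with x hx
      rw [max_eq_left (by linarith [Set.mem_Ioi.1 hx])]
    · rw [Set.indicator_of_notMem (show y ∉ Set.Iic x₀ from not_le.2 hgt)]
      refine (hasDerivAt_const x₀ (0 : E)).congr_of_eventuallyEq ?_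
      filter_upwards [Iio_mem_nhds hgt] with x hx
      rw [max_eq_right (by linarith [Set.mem_Iio.1 hx]), expInt_zero_right, zero_smul]

/-- Variation of constants from `-∞` for `m' = N m + f` when `N² = ν N` and `N c = 0`. -/
theorem isPrimitive_of_integral_eq [CompleteSpace E] {f m : ℝ → E}
    (hm : AEStronglyMeasurable f volume)
    (hf : ∀ x, IntegrableOn (fun y => ‖f y‖ * (1 + |y|)) (Set.Iic x)) {ν : ℂ} (hν : ν.re ≤ 0)
    {N : E →L[ℂ] E} (hN : ∀ v, N (N v) = ν • N v) {c : E} (hc : N c = 0)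
    (hmf : ∀ x, m x = c + ∫ y in Set.Iic x, (f y + expInt ν (x - y) • N (f y))) :
    IsPrimitive m (fun x => N (m x) + f x) := by
  set F : ℝ → E := fun x => ∫ y in Set.Iic x, f y with hFdef
  set H : ℝ → E := fun x => ∫ y in Set.Iic x, expInt ν (x - y) • f y with hHdef
  have hfi : ∀ x, IntegrableOn f (Set.Iic x) := fun x => integrableOn_of_weight hm (hf x)
  have hF : IsPrimitive F f := isPrimitive_integral_Iic hfi
  have hG : ∀ x, ∫ y in Set.Iic x, Complex.exp (ν * ((x - y : ℝ) : ℂ)) • f y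
      = F x + ν • H x := fun x => by
    rw [hFdef, hHdef]
    dsimp only
    rw [← integral_smul,
      ← integral_add (hfi x) ((integrableOn_expInt_smul hm (hf x) hν).fun_smul ν)]
    congr 1
    funext y
    rw [← one_add_mul_expInt, add_smul, one_smul, mul_smul]
  have hHd : ∀ x, HasDerivAt H (F x + ν • H x) x := fun x => by
    rw [← hG x]
    exact hasDerivAt_integral_expInt_smul hm hf hν x
  have hHc : Continuous H := continuous_iff_continuousAt.2 fun x => (hHd x).continuousAt
  have hHp : IsPrimitive H (fun x => F x + ν • H x) :=
    isPrimitive_of_hasDerivAt hHd (hF.continuous.add (hHc.const_smul ν))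
  -- Since `H' = F + ν H`, this gives `m' = f + N F + ν N H = f + N (F + N H)`, which is `f + N m`
  -- because `N c = 0`.
  have hmH : ∀ x, m x = c + (F x + N (H x)) := fun x => by
    rw [hmf x, hFdef, hHdef]
    dsimp only
    rw [← N.integral_comp_comm (integrableOn_expInt_smul hm (hf x) hν),
      ← integral_add (hfi x) (N.integrable_comp (integrableOn_expInt_smul hm (hf x) hν))]
    simp only [map_smul]
  have h1 := (hF.add (hHp.comp_clm (N.restrictScalars ℝ))).const_add c
  convert h1 using 2 with x x
  · exact hmH x
  · rw [hmH x, map_add, hc, zero_add, map_add, hN, add_comm]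
    simp

end JostIntegral

/-! ### The normalised Jost solution as a Neumann series -/

section JostFamily

variable {Λ E : Type*} [NormedAddCommGroup E] [NormedSpace ℂ E]

/-- The Volterra kernel `e^{(x-y)N} D(y)` for `N² = ν N`. -/
noncomputable def jostKernel (N : Λ → E →L[ℂ] E) (ν : Λ → ℂ) (D : ℝ → E →L[ℂ] E) (p : Λ)
    (x y : ℝ) : E →L[ℂ] E :=
  (1 + expInt (ν p) (x - y) • N p) ∘L D y

/-- A majorant of `jostKernel` on `y ≤ x ≤ X` when `‖N‖ ≤ R`. -/
noncomputable def jostBound (D : ℝ → E →L[ℂ] E) (R X : ℝ) : ℝ → ℝ :=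
  (Set.Iic X).indicator fun y => (1 + (X - y) * R) * ‖D y‖

theorem integrable_jostBound {D : ℝ → E →L[ℂ] E} (hm : AEStronglyMeasurable D volume)
    (hD : ∀ X, IntegrableOn (fun y => ‖D y‖ * (1 + |y|)) (Set.Iic X)) {R : ℝ} (hR : 0 ≤ R)
    (X : ℝ) : Integrable (jostBound D R X) := by
  refine IntegrableOn.integrable_indicator ?_ measurableSet_Iic
  -- The constant comes from `1 + (X - y) R ≤ 1 + |X| R + |y| R ≤ (1 + R + |X| R)(1 + |y|)`.
  refine ((hD X).const_mul (1 + R + |X| * R)).mono'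
    ((Continuous.aestronglyMeasurable (by fun_prop)).mul hm.norm.restrict) ?_
  filter_upwards [ae_restrict_mem measurableSet_Iic] with y hy
  have h0 : 0 ≤ (X - y) * R := mul_nonneg (sub_nonneg.2 hy) hR
  rw [norm_mul, norm_norm, Real.norm_eq_abs, abs_of_nonneg (by linarith)]
  have h1 : 1 + (X - y) * R ≤ (1 + R + |X| * R) * (1 + |y|) := by
    nlinarith [le_abs_self X, neg_abs_le y, abs_nonneg X, abs_nonneg y,
      mul_nonneg (mul_nonneg (abs_nonneg X) (abs_nonneg y)) hR, mul_nonneg (abs_nonneg y) hR,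
      mul_le_mul_of_nonneg_right (le_abs_self X) hR, mul_le_mul_of_nonneg_right (neg_abs_le y) hR]
  calc (1 + (X - y) * R) * ‖D y‖ ≤ ((1 + R + |X| * R) * (1 + |y|)) * ‖D y‖ :=
        mul_le_mul_of_nonneg_right h1 (norm_nonneg _)
    _ = _ := by ring

/-- The sign of `Re ν` gives `‖expInt ν (x - y)‖ ≤ x - y ≤ X - y`, so one majorant serves all
parameters with `‖N‖ ≤ R`. -/
theorem volterraData_jost [TopologicalSpace Λ] {N : Λ → E →L[ℂ] E} {ν : Λ → ℂ} {c : Λ → E}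
    {D : ℝ → E →L[ℂ] E} (hm : AEStronglyMeasurable D volume)
    (hD : ∀ X, IntegrableOn (fun y => ‖D y‖ * (1 + |y|)) (Set.Iic X)) {S : Set Λ}
    (hN : ContinuousOn N S) (hν : ContinuousOn ν S) (hc : ContinuousOn c S)
    (hν0 : ∀ p ∈ S, (ν p).re ≤ 0) {R C : ℝ} (hR : 0 ≤ R) (hC : 0 ≤ C)
    (hNR : ∀ p ∈ S, ‖N p‖ ≤ R) (hcC : ∀ p ∈ S, ‖c p‖ ≤ C) :
    VolterraData (jostKernel N ν D) c S (jostBound D R) C where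
  integrable := integrable_jostBound hm hD hR
  nonneg X y := Set.indicator_nonneg (fun y hy =>
    mul_nonneg (by have := mul_nonneg (sub_nonneg.2 (Set.mem_Iic.1 hy)) hR; linarith)
      (norm_nonneg _)) y
  norm_le p hp X x y hyx hxX := by
    rw [jostBound, Set.indicator_of_mem (show y ∈ Set.Iic X from hyx.trans hxX)]
    refine (ContinuousLinearMap.opNorm_comp_le _ _).trans
      (mul_le_mul_of_nonneg_right ?_ (norm_nonneg _))
    refine (norm_add_le _ _).trans (add_le_add ContinuousLinearMap.norm_id_le ?_)
    rw [norm_smul]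
    exact mul_le_mul ((norm_expInt_le (hν0 p hp) (sub_nonneg.2 hyx)).trans (by linarith))
      (hNR p hp) (norm_nonneg _) (by linarith)
  cont y := by
    have h1 : ContinuousOn (fun z : Λ × ℝ => (ν z.1, z.2 - y)) (S ×ˢ Set.univ) :=
      (hν.comp continuousOn_fst fun z hz => hz.1).prodMk (by fun_prop)
    have h2 : ContinuousOn (fun z : Λ × ℝ => N z.1) (S ×ˢ Set.univ) :=
      hN.comp continuousOn_fst fun z hz => hz.1
    exact ContinuousOn.clm_comp
      (continuousOn_const.add ((continuous_expInt.comp_continuousOn h1).smul h2)) continuousOn_const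
  meas p _ x := by
    have h1 : AEStronglyMeasurable (fun y : ℝ => 1 + expInt (ν p) (x - y) • N p) volume :=
      Continuous.aestronglyMeasurable (continuous_const.add
        ((continuous_expInt.comp (f := fun y : ℝ => (ν p, x - y)) (by fun_prop)).smul
          continuous_const))
    exact (ContinuousLinearMap.compL ℂ E E E).aestronglyMeasurable_comp₂ h1 hm
  cont_init := hc
  norm_init_le := hcC
  bound_nonneg := hC

variable [CompleteSpace E]

/-- The normalised Jost solution, as the sum of its Neumann series. -/
noncomputable def jostSol (N : Λ → E →L[ℂ] E) (ν : Λ → ℂ) (D : ℝ → E →L[ℂ] E) (c : Λ → E) :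
    Λ → ℝ → E :=
  volterraSol (jostKernel N ν D) c

theorem continuousOn_jostSol [TopologicalSpace Λ] [FirstCountableTopology Λ]
    {N : Λ → E →L[ℂ] E} {ν : Λ → ℂ} {c : Λ → E}
    {D : ℝ → E →L[ℂ] E} (hm : AEStronglyMeasurable D volume)
    (hD : ∀ X, IntegrableOn (fun y => ‖D y‖ * (1 + |y|)) (Set.Iic X)) {S : Set Λ}
    (hN : ContinuousOn N S) (hν : ContinuousOn ν S) (hc : ContinuousOn c S)
    (hν0 : ∀ p ∈ S, (ν p).re ≤ 0) (x : ℝ) : ContinuousOn (fun p => jostSol N ν D c p x) S := by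
  intro p₀ hp₀
  -- The norms of `N` and `c` need not be bounded on all of `S`, but continuity bounds them near
  -- `p₀`.
  set S' := {p ∈ S | ‖N p‖ ≤ ‖N p₀‖ + 1 ∧ ‖c p‖ ≤ ‖c p₀‖ + 1} with hS'
  have hsub : S' ⊆ S := fun p hp => hp.1
  have hV := volterraData_jost hm hD (hN.mono hsub) (hν.mono hsub) (hc.mono hsub)
    (fun p hp => hν0 p hp.1) (R := ‖N p₀‖ + 1) (C := ‖c p₀‖ + 1) (by positivity) (by positivity)
    (fun p hp => hp.2.1) (fun p hp => hp.2.2)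
  have h1 : ContinuousOn (fun p => jostSol N ν D c p x) S' :=
    hV.continuousOn_sol.comp (f := fun p => (p, x)) (by fun_prop) fun p hp => ⟨hp, Set.mem_univ _⟩
  refine (h1 p₀ ⟨hp₀, by simp, by simp⟩).mono_of_mem_nhdsWithin ?_
  filter_upwards [self_mem_nhdsWithin,
    (hN p₀ hp₀).norm.eventually_lt_const (show ‖N p₀‖ < ‖N p₀‖ + 1 by linarith),
    (hc p₀ hp₀).norm.eventually_lt_const (show ‖c p₀‖ < ‖c p₀‖ + 1 by linarith)]
    with p h1 h2 h3 using ⟨h1, h2.le, h3.le⟩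

theorem differentiableOn_jostSol {N : ℂ → E →L[ℂ] E} {ν : ℂ → ℂ} {c : ℂ → E}
    {D : ℝ → E →L[ℂ] E} (hm : AEStronglyMeasurable D volume)
    (hD : ∀ X, IntegrableOn (fun y => ‖D y‖ * (1 + |y|)) (Set.Iic X)) {U : Set ℂ} (hU : IsOpen U)
    (hN : DifferentiableOn ℂ N U) (hν : DifferentiableOn ℂ ν U) (hc : DifferentiableOn ℂ c U)
    (hν0 : ∀ p ∈ U, (ν p).re ≤ 0) (x : ℝ) :
    DifferentiableOn ℂ (fun p => jostSol N ν D c p x) U := by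
  intro p₀ hp₀
  have hnh : {p ∈ U | ‖N p‖ ≤ ‖N p₀‖ + 1 ∧ ‖c p‖ ≤ ‖c p₀‖ + 1} ∈ 𝓝 p₀ := by
    filter_upwards [hU.mem_nhds hp₀,
      (hN.continuousOn.continuousAt (hU.mem_nhds hp₀)).norm.eventually_lt_const
        (show ‖N p₀‖ < ‖N p₀‖ + 1 by linarith),
      (hc.continuousOn.continuousAt (hU.mem_nhds hp₀)).norm.eventually_lt_const
        (show ‖c p₀‖ < ‖c p₀‖ + 1 by linarith)] with p h1 h2 h3 using ⟨h1, h2.le, h3.le⟩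
  obtain ⟨W, hWsub, hWo, hpW⟩ := mem_nhds_iff.1 hnh
  have hWU : W ⊆ U := fun p hp => (hWsub hp).1
  have hV := volterraData_jost hm hD (hN.continuousOn.mono hWU) (hν.continuousOn.mono hWU)
    (hc.continuousOn.mono hWU) (fun p hp => hν0 p (hWU hp)) (R := ‖N p₀‖ + 1) (C := ‖c p₀‖ + 1)
    (by positivity) (by positivity) (fun p hp => (hWsub hp).2.1) (fun p hp => (hWsub hp).2.2)
  refine ((hV.differentiableOn_sol hWo (fun x y => ?_) (hc.mono hWU) x).differentiableAt
    (hWo.mem_nhds hpW)).differentiableWithinAt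
  refine DifferentiableOn.clm_comp ?_ (differentiableOn_const _)
  exact (differentiableOn_const _).add
    (((differentiable_expInt _).comp_differentiableOn (hν.mono hWU)).smul (hN.mono hWU))

theorem isPrimitive_jostSol_and_tendsto {N : Λ → E →L[ℂ] E} {ν : Λ → ℂ} {c : Λ → E}
    {D : ℝ → E →L[ℂ] E} (hm : AEStronglyMeasurable D volume)
    (hD : ∀ X, IntegrableOn (fun y => ‖D y‖ * (1 + |y|)) (Set.Iic X)) {p : Λ}
    (hν0 : (ν p).re ≤ 0) (hN : ∀ v, N p (N p v) = ν p • N p v) (hc : N p (c p) = 0) :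
    IsPrimitive (jostSol N ν D c p)
      (fun x => N p (jostSol N ν D c p x) + D x (jostSol N ν D c p x)) ∧
    Tendsto (jostSol N ν D c p) atBot (𝓝 (c p)) := by
  -- The claim concerns a single parameter, and continuity on `{p}` holds for any topology, so an
  -- arbitrary first countable one is chosen.
  let _ : TopologicalSpace Λ := ⊤
  have : FirstCountableTopology Λ := inferInstance
  have hV : VolterraData (jostKernel N ν D) c {p} (jostBound D ‖N p‖) ‖c p‖ :=
    volterraData_jost hm hD (continuousOn_singleton _ _) (continuousOn_singleton _ _)
      (continuousOn_singleton _ _) (by simpa using hν0) (norm_nonneg _) (norm_nonneg _) (by simp)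
      (by simp)
  have hp : p ∈ ({p} : Set Λ) := rfl
  have hcont : Continuous (jostSol N ν D c p) := hV.continuous_right hV.continuousOn_sol hp
  have heq : ∀ x, jostSol N ν D c p x = c p + ∫ y in Set.Iic x,
      jostKernel N ν D p x y (jostSol N ν D c p y) := hV.sol_eq hp
  have hfm : AEStronglyMeasurable (fun y => D y (jostSol N ν D c p y)) volume :=
    (ContinuousLinearMap.id ℂ (E →L[ℂ] E)).aestronglyMeasurable_comp₂ hm hcont.aestronglyMeasurable
  refine ⟨isPrimitive_of_integral_eq hfm (fun x => ?_) hν0 hN hc (fun x => ?_), ?_⟩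
  · refine ((hD x).mul_const (‖c p‖ * Real.exp (massIic (jostBound D ‖N p‖ x) x))).mono'
      (hfm.norm.restrict.mul (Continuous.aestronglyMeasurable (by fun_prop))) ?_
    filter_upwards [ae_restrict_mem measurableSet_Iic] with y hy
    have h1 := hV.norm_sol_le hp (Set.mem_Iic.1 hy)
    rw [Real.norm_eq_abs, abs_of_nonneg (by positivity)]
    calc ‖D y (jostSol N ν D c p y)‖ * (1 + |y|)
        ≤ (‖D y‖ * (‖c p‖ * Real.exp (massIic (jostBound D ‖N p‖ x) x))) * (1 + |y|) := by
          gcongr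
          exact (ContinuousLinearMap.le_opNorm _ _).trans
            (mul_le_mul_of_nonneg_left h1 (norm_nonneg _))
      _ = _ := by ring
  · rw [heq x]
    simp [jostKernel]
  · rw [tendsto_iff_norm_sub_tendsto_zero]
    -- For `x ≤ 0` the correction to `c` is at most a constant times the mass of the majorant to the
    -- left of `x`.
    have hlim := (tendsto_integral_Iic_atBot (f := jostBound D ‖N p‖ 0)
      fun x => (hV.integrable 0).integrableOn).mul_const
      (‖c p‖ * Real.exp (massIic (jostBound D ‖N p‖ 0) 0))
    rw [zero_mul] at hlim
    refine squeeze_zero' (Eventually.of_forall fun _ => norm_nonneg _) ?_ hlim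
    filter_upwards [eventually_le_atBot (0 : ℝ)] with x hx
    rw [heq x, add_sub_cancel_left, ← integral_mul_const]
    refine norm_integral_le_of_norm_le ((hV.integrable 0).integrableOn.mul_const _) ?_
    filter_upwards [ae_restrict_mem measurableSet_Iic] with y hy
    exact hV.norm_apply_le hp hy hx (hV.norm_sol_le hp (le_trans hy hx))

end JostFamily

/-! ### Matrices as operators -/

section MatrixAction

/-- A `2 × 2` matrix as an operator on `ℂ²`. -/
noncomputable def mulVecCLM :
    Matrix (Fin 2) (Fin 2) ℂ →ₗ[ℂ] ((Fin 2 → ℂ) →L[ℂ] (Fin 2 → ℂ)) :=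
  LinearMap.toContinuousLinearMap.toLinearMap ∘ₗ Matrix.toLin'.toLinearMap

@[simp]
theorem mulVecCLM_apply (A : Matrix (Fin 2) (Fin 2) ℂ) (v : Fin 2 → ℂ) :
    mulVecCLM A v = A.mulVec v := by
  simp [mulVecCLM]

theorem mulVecCLM_eq_sum (A : Matrix (Fin 2) (Fin 2) ℂ) :
    mulVecCLM A = ∑ i, ∑ j, A i j • mulVecCLM (Matrix.single i j 1) := by
  conv_lhs => rw [Matrix.matrix_eq_sum_single A]
  simp only [map_sum]
  refine Finset.sum_congr rfl fun i _ => Finset.sum_congr rfl fun j _ => ?_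
  rw [← map_smul, Matrix.smul_single, smul_eq_mul, mul_one]

end MatrixAction

/-! ### Measurability and integrability of the perturbation -/

section Potential

/-- A zero-diagonal potential `V` that tends to `V₀` at `-∞`, with the difference in `L^{1,1}` on
all left half-lines. -/
structure DecayingPotential (V : ℝ → Matrix (Fin 2) (Fin 2) ℂ) (V₀ : Matrix (Fin 2) (Fin 2) ℂ) :
    Prop where
  diag_zero : ∀ x i, V x i i = 0
  memL11 : ∀ X i j, MemL11 (Set.Iic X) (fun x => (V x - V₀) i j)

namespace DecayingPotential

variable {V : ℝ → Matrix (Fin 2) (Fin 2) ℂ} {V₀ : Matrix (Fin 2) (Fin 2) ℂ}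

theorem aestronglyMeasurable (h : DecayingPotential V V₀) :
    AEStronglyMeasurable (fun x => mulVecCLM (V x - V₀)) volume := by
  have hu : ⋃ n : ℕ, Set.Iic (n : ℝ) = Set.univ :=
    Set.eq_univ_of_forall fun x => Set.mem_iUnion.2 (exists_nat_ge x)
  rw [← Measure.restrict_univ (μ := volume), ← hu, aestronglyMeasurable_iUnion_iff]
  intro n
  simp_rw [mulVecCLM_eq_sum (V _ - V₀)]
  refine Finset.aestronglyMeasurable_fun_sum _ fun i _ =>
    Finset.aestronglyMeasurable_fun_sum _ fun j _ => ?_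
  exact (h.memL11 n i j).1.smul_const _

theorem integrableOn (h : DecayingPotential V V₀) (X : ℝ) :
    IntegrableOn (fun x => ‖mulVecCLM (V x - V₀)‖ * (1 + |x|)) (Set.Iic X) := by
  have h1 : IntegrableOn (fun x => ∑ i, ∑ j, ‖(V x - V₀) i j‖ * (1 + |x|) *
      ‖mulVecCLM (Matrix.single i j 1)‖) (Set.Iic X) :=
    integrable_finsetSum _ fun i _ => integrable_finsetSum _ fun j _ =>
      (h.memL11 X i j).2.mul_const _
  refine h1.mono' (h.aestronglyMeasurable.norm.restrict.mul
    (Continuous.aestronglyMeasurable (by fun_prop))) (Eventually.of_forall fun x => ?_)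
  have h0 : 0 ≤ 1 + |x| := by positivity
  rw [norm_mul, norm_norm, Real.norm_eq_abs, abs_of_nonneg h0, mulVecCLM_eq_sum (V x - V₀)]
  refine (mul_le_mul_of_nonneg_right ((norm_sum_le _ _).trans
    (Finset.sum_le_sum fun i _ => norm_sum_le _ _)) h0).trans_eq ?_
  rw [Finset.sum_mul]
  refine Finset.sum_congr rfl fun i _ => ?_
  rw [Finset.sum_mul]
  refine Finset.sum_congr rfl fun j _ => ?_
  rw [norm_smul]
  ring

theorem intervalIntegrable_norm (h : DecayingPotential V V₀) (A : Matrix (Fin 2) (Fin 2) ℂ)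
    (a b : ℝ) : IntervalIntegrable (fun x => ‖mulVecCLM (A + V x)‖) volume a b := by
  have h1 : IntervalIntegrable (fun x => mulVecCLM (V x - V₀)) volume a b := by
    rw [intervalIntegrable_iff]
    exact (integrableOn_of_weight h.aestronglyMeasurable (h.integrableOn (max a b))).mono_set
      fun y hy => hy.2
  have h2 := ((intervalIntegrable_const (c := mulVecCLM (A + V₀))).add h1).norm
  refine h2.congr fun x _ => ?_
  rw [← map_add]
  congr 2
  abel

end DecayingPotential

end Potential

/-! ### Wronskian, uniqueness and reflection -/

section Solutions

variable {V : ℝ → Matrix (Fin 2) (Fin 2) ℂ} {V₀ : Matrix (Fin 2) (Fin 2) ℂ} {k μ : ℂ}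

theorem isSolution_iff {v : ℝ → Fin 2 → ℂ} :
    IsSolution V k v ↔ IsPrimitive v (fun s => ((Complex.I * k) • J + V s).mulVec (v s)) :=
  ⟨fun h => h.2, fun h => ⟨h.continuous, h⟩⟩

theorem IsSolution.sub {v w : ℝ → Fin 2 → ℂ} (hv : IsSolution V k v) (hw : IsSolution V k w) :
    IsSolution V k (fun x => v x - w x) := by
  rw [isSolution_iff] at *
  simpa only [Matrix.mulVec_sub] using hv.sub hw

theorem IsSolution.const_smul {v : ℝ → Fin 2 → ℂ} (hv : IsSolution V k v) (a : ℂ) :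
    IsSolution V k (fun x => a • v x) := by
  rw [isSolution_iff] at *
  have := hv.comp_clm ((a • ContinuousLinearMap.id ℂ (Fin 2 → ℂ)).restrictScalars ℝ)
  simpa [Matrix.mulVec_smul] using this

theorem IsSolution.eq_zero (hV : DecayingPotential V V₀) {v : ℝ → Fin 2 → ℂ}
    (hv : IsSolution V k v) {a : ℝ} (ha : v a = 0) (x : ℝ) : v x = 0 :=
  eq_zero_of_isPrimitive_of_norm_le (isSolution_iff.1 hv)
    (fun a b => hV.intervalIntegrable_norm ((Complex.I * k) • J) a b) (fun _ => norm_nonneg _)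
    (fun s => by
      rw [← mulVecCLM_apply]
      exact ContinuousLinearMap.le_opNorm _ _) ha x

/-- The derivative of the Wronskian is the trace of the coefficient matrix times the Wronskian, and
both `J` and `V` have trace zero. -/
theorem IsSolution.wronskian_eq (hd : ∀ x i, V x i i = 0) {v w : ℝ → Fin 2 → ℂ}
    (hv : IsSolution V k v) (hw : IsSolution V k w) (a b : ℝ) :
    v a 0 * w a 1 - v a 1 * w a 0 = v b 0 * w b 1 - v b 1 * w b 0 := by
  have hc : ∀ {u : ℝ → Fin 2 → ℂ}, IsSolution V k u → ∀ i, IsPrimitive (fun x => u x i)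
      (fun s => ((Complex.I * k) • J + V s).mulVec (u s) i) := fun hu i =>
    (isSolution_iff.1 hu).comp_clm (ContinuousLinearMap.proj (R := ℝ) (φ := fun _ : Fin 2 => ℂ) i)
  have h := (((hc hv 0).smul (hc hw 1)).sub ((hc hv 1).smul (hc hw 0)) b a).2
  simp only [smul_eq_mul] at h
  rw [← sub_eq_zero, h, ← intervalIntegral.integral_zero (a := b) (b := a) (μ := volume)]
  congr 1
  funext s
  simp [Matrix.mulVec, dotProduct, Fin.sum_univ_two, J, hd]
  ring

/-- The difference `u` of two Jost solutions is `o(e^{iμx})`, so its constant Wronskian with `v`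
vanishes, which makes `u` a multiple `s v`. The normalisation then gives `s c = 0`. -/
theorem IsJost.unique (hV : DecayingPotential V V₀) (hμ : μ.im ≤ 0) {c : Fin 2 → ℂ} (hc : c ≠ 0)
    {v w : ℝ → Fin 2 → ℂ} (hv : IsJost V k μ atBot c v) (hw : IsJost V k μ atBot c w) : v = w := by
  have hu : IsSolution V k (fun x => v x - w x) := hv.1.sub hw.1
  have hulim : Tendsto (fun x : ℝ => Complex.exp (-(Complex.I * μ * x)) • (v x - w x)) atBot
      (𝓝 0) := by
    simpa [smul_sub] using hv.2.sub hw.2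
  set u := fun x => v x - w x with hudef
  have hW : ∀ x, u x 0 * v x 1 - u x 1 * v x 0 = 0 := by
    intro x₀
    have h1 : Tendsto (fun x : ℝ => Complex.exp (-(Complex.I * μ * x)) ^ 2 *
        (u x₀ 0 * v x₀ 1 - u x₀ 1 * v x₀ 0)) atBot (𝓝 0) := by
      have hu' := tendsto_pi_nhds.1 hulim
      have hv' := tendsto_pi_nhds.1 hv.2
      have := ((hu' 0).mul (hv' 1)).sub ((hu' 1).mul (hv' 0))
      simp only [Pi.zero_apply, zero_mul, sub_zero] at this
      refine this.congr fun x => ?_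
      rw [hu.wronskian_eq hV.diag_zero hv.1 x₀ x]
      simp only [Pi.smul_apply, smul_eq_mul, hudef]
      ring
    rw [← norm_le_zero_iff]
    -- For `x ≤ 0` and `Im μ ≤ 0` the factor `e^{-2iμx}` has modulus at least one, so it cannot be
    -- responsible for the limit zero.
    refine le_of_tendsto_of_tendsto tendsto_const_nhds (by simpa using h1.norm) ?_
    filter_upwards [eventually_le_atBot (0 : ℝ)] with x hx
    refine le_mul_of_one_le_left (norm_nonneg _) (one_le_pow₀ ?_)
    rw [Complex.norm_exp, Real.one_le_exp_iff]
    simpa using mul_nonneg_of_nonpos_of_nonpos hμ hx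
  obtain ⟨x₀, hx₀⟩ : ∃ x₀, v x₀ ≠ 0 := by
    by_contra! h
    refine hc (tendsto_nhds_unique hv.2 ?_)
    simp [h]
  obtain ⟨s, hs⟩ : ∃ s : ℂ, u x₀ = s • v x₀ := by
    have h1 := hW x₀
    by_cases h0 : v x₀ 0 = 0
    · have h2 : v x₀ 1 ≠ 0 := fun h2 => hx₀ (by ext i; fin_cases i <;> simp [h0, h2])
      refine ⟨u x₀ 1 / v x₀ 1, ?_⟩
      ext i
      fin_cases i
      · have : u x₀ 0 = 0 := by simpa [h0, h2] using h1
        simp [h0, this]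
      · simp [h2]
    · refine ⟨u x₀ 0 / v x₀ 0, ?_⟩
      ext i
      fin_cases i
      · simp [h0]
      · simp only [Fin.mk_one, Pi.smul_apply, smul_eq_mul]
        field_simp
        linear_combination -h1
  have hus : ∀ x, u x = s • v x := fun x =>
    sub_eq_zero.1 ((hu.sub (hv.1.const_smul s)).eq_zero hV (a := x₀) (by simp [hs]) x)
  have hs0 : s • c = 0 := by
    refine tendsto_nhds_unique ((hv.2.const_smul s).congr fun x => ?_) hulim
    rw [smul_comm, ← hus x]
  have hs1 : s = 0 := (smul_eq_zero.1 hs0).resolve_right hc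
  funext x
  have := hus x
  rw [hs1, zero_smul] at this
  exact sub_eq_zero.1 this

theorem IsJost.comp_neg {l l' : Filter ℝ} (hl : Tendsto Neg.neg l' l) {c : Fin 2 → ℂ}
    {v : ℝ → Fin 2 → ℂ} (hv : IsJost V k μ l c v) :
    IsJost (fun x => -V (-x)) (-k) (-μ) l' c (fun x => v (-x)) := by
  refine ⟨?_, ?_⟩
  · rw [isSolution_iff]
    convert (isSolution_iff.1 hv.1).comp_neg using 2 with x
    rw [← Matrix.neg_mulVec]
    congr 1
    rw [neg_add, mul_neg, neg_smul]
  · refine (hv.2.comp hl).congr fun x => ?_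
    simp

theorem isJost_atTop_iff {c : Fin 2 → ℂ} {v : ℝ → Fin 2 → ℂ} :
    IsJost V k μ atTop c v ↔
      IsJost (fun x => -V (-x)) (-k) (-μ) atBot c (fun x => v (-x)) :=
  ⟨fun h => h.comp_neg tendsto_neg_atBot_atTop, fun h => by
    simpa using h.comp_neg tendsto_neg_atTop_atBot⟩

end Solutions

/-! ### Existence and regularity of the Jost functions -/

section JostFunctions

/-- The algebraic conditions under which a Jost solution at `-∞` with asymptotics `c e^{iμx}`
exists. -/
structure IsJostPoint (V₀ : Matrix (Fin 2) (Fin 2) ℂ) (k μ : ℂ) (c : Fin 2 → ℂ) : Prop where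
  mulVec_mulVec : ∀ v, ((Complex.I * k) • J + V₀).mulVec (((Complex.I * k) • J + V₀).mulVec v)
    = -μ ^ 2 • v
  mulVec_eq : ((Complex.I * k) • J + V₀).mulVec c = (Complex.I * μ) • c
  im_nonpos : μ.im ≤ 0
  ne_zero : c ≠ 0

/-- The matrix `i k J + V₀ - i μ` of the equation satisfied by `e^{-iμx} v`. -/
noncomputable def jostMatrix (V₀ : Matrix (Fin 2) (Fin 2) ℂ) (k μ : ℂ) :
    (Fin 2 → ℂ) →L[ℂ] (Fin 2 → ℂ) :=
  (Complex.I * k) • mulVecCLM J + mulVecCLM V₀ - (Complex.I * μ) • 1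

/-- `e^{-iμx} v(x)` for the Jost solution `v`. -/
noncomputable def jostFun (V : ℝ → Matrix (Fin 2) (Fin 2) ℂ) (l : Filter ℝ) (k μ : ℂ)
    (c : Fin 2 → ℂ) (x : ℝ) : Fin 2 → ℂ :=
  Complex.exp (-(Complex.I * μ * x)) • Classical.epsilon (IsJost V k μ l c) x

variable {V : ℝ → Matrix (Fin 2) (Fin 2) ℂ} {V₀ : Matrix (Fin 2) (Fin 2) ℂ}

theorem jostMatrix_apply (k μ : ℂ) (v : Fin 2 → ℂ) :
    jostMatrix V₀ k μ v = ((Complex.I * k) • J + V₀).mulVec v - (Complex.I * μ) • v := by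
  simp [jostMatrix, Matrix.add_mulVec, Matrix.smul_mulVec]

variable {Λ : Type*} {k μ : Λ → ℂ} {c : Λ → Fin 2 → ℂ}

/-- From `A² = -μ²` and `N = A - iμ` follows `N² = -2iμ N`, which puts the equation for `e^{-iμx} v`
in the form solved above. -/
theorem isJost_exp_smul_jostSol (hV : DecayingPotential V V₀) {p : Λ}
    (hp : IsJostPoint V₀ (k p) (μ p) (c p)) :
    IsJost V (k p) (μ p) atBot (c p) (fun x => Complex.exp (Complex.I * μ p * x) •
      jostSol (fun p => jostMatrix V₀ (k p) (μ p)) (fun p => -2 * Complex.I * μ p)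
        (fun x => mulVecCLM (V x - V₀)) c p x) := by
  obtain ⟨h1, h2⟩ := isPrimitive_jostSol_and_tendsto (N := fun p => jostMatrix V₀ (k p) (μ p))
    (ν := fun p => -2 * Complex.I * μ p) (c := c) hV.aestronglyMeasurable hV.integrableOn (p := p)
    (by have := hp.im_nonpos; simp; linarith)
    (fun v => by
      simp only [jostMatrix_apply, Matrix.mulVec_sub, Matrix.mulVec_smul, hp.mulVec_mulVec]
      ext i
      simp only [Pi.sub_apply, Pi.smul_apply, smul_eq_mul]
      linear_combination -(μ p ^ 2 * v i) * Complex.I_sq)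
    (by simp only [jostMatrix_apply, hp.mulVec_eq, sub_self])
  refine ⟨?_, ?_⟩
  · rw [isSolution_iff]
    have hu : IsPrimitive (fun x : ℝ => Complex.exp (Complex.I * μ p * x))
        (fun x : ℝ => Complex.exp (Complex.I * μ p * x) * (Complex.I * μ p)) := by
      refine isPrimitive_of_hasDerivAt (fun x => ?_) (by fun_prop)
      have h0 : HasDerivAt (fun s : ℝ => Complex.I * μ p * (s : ℂ)) (Complex.I * μ p) x := by
        simpa using ((hasDerivAt_id x).ofReal_comp).const_mul (Complex.I * μ p)
      exact h0.cexp
    refine (hu.smul h1).congr_right fun x => ?_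
    simp only [jostMatrix_apply, mulVecCLM_apply, Matrix.sub_mulVec, Matrix.add_mulVec,
      Matrix.mulVec_smul]
    ext i
    simp only [Pi.add_apply, Pi.sub_apply, Pi.smul_apply, smul_eq_mul]
    ring
  · refine h2.congr fun x => ?_
    rw [smul_smul, ← Complex.exp_add, neg_add_cancel, Complex.exp_zero, one_smul]

theorem existsUnique_isJost_atBot (hV : DecayingPotential V V₀) {k μ : ℂ} {c : Fin 2 → ℂ}
    (hp : IsJostPoint V₀ k μ c) : ∃! v, IsJost V k μ atBot c v := by
  have h := isJost_exp_smul_jostSol (Λ := Unit) (k := fun _ => k) (μ := fun _ => μ)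
    (c := fun _ => c) (p := ()) hV hp
  exact ⟨_, h, fun w hw => hw.unique hV hp.im_nonpos hp.ne_zero h⟩

/-- By uniqueness the solution picked by choice is the one built from the Neumann series, so the
regularity of the series carries over. -/
theorem jostFun_atBot_eq (hV : DecayingPotential V V₀) {p : Λ}
    (hp : IsJostPoint V₀ (k p) (μ p) (c p)) (x : ℝ) :
    jostFun V atBot (k p) (μ p) (c p) x =
      jostSol (fun p => jostMatrix V₀ (k p) (μ p)) (fun p => -2 * Complex.I * μ p)
        (fun x => mulVecCLM (V x - V₀)) c p x := by
  have h := isJost_exp_smul_jostSol hV hp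
  rw [jostFun, (Classical.epsilon_spec (p := IsJost V (k p) (μ p) atBot (c p)) ⟨_, h⟩).unique hV
    hp.im_nonpos hp.ne_zero h, smul_smul, ← Complex.exp_add, neg_add_cancel, Complex.exp_zero,
    one_smul]

theorem continuousOn_jostFun_atBot [TopologicalSpace Λ] [FirstCountableTopology Λ]
    (hV : DecayingPotential V V₀) {S : Set Λ} (hk : ContinuousOn k S) (hμ : ContinuousOn μ S)
    (hc : ContinuousOn c S) (hp : ∀ p ∈ S, IsJostPoint V₀ (k p) (μ p) (c p)) (x : ℝ) :
    ContinuousOn (fun p => jostFun V atBot (k p) (μ p) (c p) x) S := by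
  refine (continuousOn_jostSol hV.aestronglyMeasurable hV.integrableOn
    (N := fun p => jostMatrix V₀ (k p) (μ p)) (ν := fun p => -2 * Complex.I * μ p) ?_ ?_ hc
    (fun p h => by have := (hp p h).im_nonpos; simp; linarith) x).congr
      fun p h => jostFun_atBot_eq hV (hp p h) x
  · unfold jostMatrix
    fun_prop
  · fun_prop

theorem analyticOnNhd_jostFun_atBot {k μ : ℂ → ℂ} {c : ℂ → Fin 2 → ℂ}
    (hV : DecayingPotential V V₀) {U : Set ℂ} (hU : IsOpen U) (hk : DifferentiableOn ℂ k U)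
    (hμ : DifferentiableOn ℂ μ U) (hc : DifferentiableOn ℂ c U)
    (hp : ∀ p ∈ U, IsJostPoint V₀ (k p) (μ p) (c p)) (x : ℝ) :
    AnalyticOnNhd ℂ (fun p => jostFun V atBot (k p) (μ p) (c p) x) U := by
  refine DifferentiableOn.analyticOnNhd ?_ hU
  refine (differentiableOn_jostSol hV.aestronglyMeasurable hV.integrableOn hU
    (N := fun p => jostMatrix V₀ (k p) (μ p)) (ν := fun p => -2 * Complex.I * μ p) ?_ ?_ hc
    (fun p h => by have := (hp p h).im_nonpos; simp; linarith) x).congr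
      fun p h => jostFun_atBot_eq hV (hp p h) x
  · unfold jostMatrix
    fun_prop
  · fun_prop

theorem existsUnique_isJost_atTop (hV : DecayingPotential (fun x => -V (-x)) (-V₀)) {k μ : ℂ}
    {c : Fin 2 → ℂ} (hp : IsJostPoint (-V₀) (-k) (-μ) c) : ∃! v, IsJost V k μ atTop c v := by
  obtain ⟨w, hw, hw'⟩ := existsUnique_isJost_atBot hV hp
  refine ⟨fun x => w (-x), isJost_atTop_iff.2 (by simpa using hw), fun v hv => ?_⟩
  have := hw' _ (isJost_atTop_iff.1 hv)
  funext x
  rw [← this]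
  simp

theorem jostFun_atTop_eq (hV : DecayingPotential (fun x => -V (-x)) (-V₀)) {k μ : ℂ}
    {c : Fin 2 → ℂ} (hp : IsJostPoint (-V₀) (-k) (-μ) c) (x : ℝ) :
    jostFun V atTop k μ c x = jostFun (fun x => -V (-x)) atBot (-k) (-μ) c (-x) := by
  have h1 := Classical.epsilon_spec (existsUnique_isJost_atTop hV hp).exists
  have h2 := Classical.epsilon_spec (existsUnique_isJost_atBot hV hp).exists
  have h3 := congrFun ((isJost_atTop_iff.1 h1).unique hV hp.im_nonpos hp.ne_zero h2) (-x)
  simp only [neg_neg] at h3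
  rw [jostFun, jostFun, h3]
  simp

end JostFunctions

/-! ### The sign of `Im λ` and the analyticity of `λ` on sheet I -/

section Sheet

theorem angle_mem_of_re_pos {z : ℂ} (hz : 0 < z.re) :
    angle z ∈ Set.Ioo (-(Real.pi / 2)) (Real.pi / 2) := by
  have h := abs_lt.1 (Complex.abs_arg_lt_pi_div_two_iff.2 (Or.inl hz))
  rw [angle, if_neg (not_lt.2 h.1.le)]
  exact h

theorem angle_mem_of_re_neg {z : ℂ} (hz : z.re < 0) :
    angle z ∈ Set.Ioo (Real.pi / 2) (3 * Real.pi / 2) := by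
  have h : Real.pi / 2 < |z.arg| :=
    not_le.1 fun h => not_le.2 hz (Complex.abs_arg_le_pi_div_two_iff.1 h)
  have h1 := Complex.neg_pi_lt_arg z
  have h2 := Complex.arg_le_pi z
  rw [angle]
  split_ifs with h3
  · constructor <;> linarith
  · rcases lt_abs.1 h with h4 | h4
    · constructor <;> linarith [Real.pi_pos]
    · exact absurd (by linarith) h3

variable {q₀ : ℝ}

theorem lamI_re (q₀ : ℝ) (k : ℂ) : (lamI q₀ k).re =
    Real.sqrt (‖k - Complex.I * q₀‖ * ‖k + Complex.I * q₀‖) *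
      Real.cos ((angle (k - Complex.I * q₀) + angle (k + Complex.I * q₀)) / 2) := by
  rw [lamI, Complex.re_ofReal_mul, ← Complex.exp_ofReal_mul_I_re,
    mul_comm (Complex.ofReal _) Complex.I]

theorem lamI_im (q₀ : ℝ) (k : ℂ) : (lamI q₀ k).im =
    Real.sqrt (‖k - Complex.I * q₀‖ * ‖k + Complex.I * q₀‖) *
      Real.sin ((angle (k - Complex.I * q₀) + angle (k + Complex.I * q₀)) / 2) := by
  rw [lamI, Complex.im_ofReal_mul, ← Complex.exp_ofReal_mul_I_im,
    mul_comm (Complex.ofReal _) Complex.I]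

theorem sqrt_norm_mul_norm_pos {k : ℂ} (h1 : k - Complex.I * q₀ ≠ 0)
    (h2 : k + Complex.I * q₀ ≠ 0) :
    0 < Real.sqrt (‖k - Complex.I * q₀‖ * ‖k + Complex.I * q₀‖) :=
  Real.sqrt_pos.2 (mul_pos (norm_pos_iff.2 h1) (norm_pos_iff.2 h2))

theorem sub_ne_zero_of_re_ne_zero {k : ℂ} (hk : k.re ≠ 0) :
    k - Complex.I * q₀ ≠ 0 ∧ k + Complex.I * q₀ ≠ 0 :=
  ⟨fun h => hk (by simpa using congrArg Complex.re h),
    fun h => hk (by simpa using congrArg Complex.re h)⟩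

theorem lamI_re_pos {k : ℂ} (hk : 0 < k.re) : 0 < (lamI q₀ k).re := by
  have h := sub_ne_zero_of_re_ne_zero (q₀ := q₀) hk.ne'
  rw [lamI_re]
  refine mul_pos (sqrt_norm_mul_norm_pos h.1 h.2) (Real.cos_pos_of_mem_Ioo ?_)
  have h1 := angle_mem_of_re_pos (z := k - Complex.I * q₀) (by simpa using hk)
  have h2 := angle_mem_of_re_pos (z := k + Complex.I * q₀) (by simpa using hk)
  constructor <;> linarith [h1.1, h1.2, h2.1, h2.2]

theorem lamI_re_neg {k : ℂ} (hk : k.re < 0) : (lamI q₀ k).re < 0 := by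
  have h := sub_ne_zero_of_re_ne_zero (q₀ := q₀) hk.ne
  rw [lamI_re]
  have h1 := angle_mem_of_re_neg (z := k - Complex.I * q₀) (by simpa using hk)
  have h2 := angle_mem_of_re_neg (z := k + Complex.I * q₀) (by simpa using hk)
  refine mul_neg_of_pos_of_neg (sqrt_norm_mul_norm_pos h.1 h.2)
    (Real.cos_neg_of_pi_div_two_lt_of_lt ?_ ?_) <;> linarith [h1.1, h1.2, h2.1, h2.2]

theorem re_mul_im_eq_of_sq_eq {k l : ℂ} (h : l ^ 2 = k ^ 2 + (q₀ : ℂ) ^ 2) :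
    l.re * l.im = k.re * k.im := by
  have h' := congrArg Complex.im h
  simp [sq] at h'
  linarith

theorem re_sq_sub_im_sq_eq_of_sq_eq {k l : ℂ} (h : l ^ 2 = k ^ 2 + (q₀ : ℂ) ^ 2) :
    l.re ^ 2 - l.im ^ 2 = k.re ^ 2 - k.im ^ 2 + q₀ ^ 2 := by
  have h' := congrArg Complex.re h
  simp [sq] at h'
  linarith

theorem arg_of_re_eq_zero_of_im_pos {z : ℂ} (h0 : z.re = 0) (h : 0 < z.im) :
    z.arg = Real.pi / 2 := Complex.arg_eq_pi_div_two_iff.2 ⟨h0, h⟩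

theorem arg_of_re_eq_zero_of_im_neg {z : ℂ} (h0 : z.re = 0) (h : z.im < 0) :
    z.arg = -(Real.pi / 2) := Complex.arg_eq_neg_pi_div_two_iff.2 ⟨h0, h⟩

/-- The imaginary part of `λ² = k² + q₀²` gives `Re λ · Im λ = Re k · Im k`, and `Re λ` has the sign
of `Re k`. On the imaginary axis above the cut this says nothing, and the angles are computed
directly. -/
theorem lamI_im_pos (hq : 0 < q₀) {k : ℂ} (hk : k ∈ upperCut q₀) : 0 < (lamI q₀ k).im := by
  have hp := re_mul_im_eq_of_sq_eq (lamI_sq q₀ k)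
  have him : 0 < k.im := hk.1
  rcases lt_trichotomy k.re 0 with h | h | h
  · nlinarith [lamI_re_neg (q₀ := q₀) h, mul_neg_of_neg_of_pos h him]
  · have h1 : q₀ < k.im := by
      by_contra! h1
      exact hk.2 ⟨h, by rwa [abs_of_pos him]⟩
    have e1 : angle (k - Complex.I * q₀) = Real.pi / 2 := by
      rw [angle, arg_of_re_eq_zero_of_im_pos (by simpa using h) (by simpa using h1),
        if_neg (by linarith [Real.pi_pos])]
    have e2 : angle (k + Complex.I * q₀) = Real.pi / 2 := by
      rw [angle, arg_of_re_eq_zero_of_im_pos (by simpa using h) (by simp; linarith),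
        if_neg (by linarith [Real.pi_pos])]
    rw [lamI_im, e1, e2, add_self_div_two, Real.sin_pi_div_two, mul_one]
    refine sqrt_norm_mul_norm_pos (fun h2 => ?_) (fun h2 => ?_) <;>
    · have := congrArg Complex.im h2
      simp at this
      linarith
  · nlinarith [lamI_re_pos (q₀ := q₀) h, mul_pos h him]

theorem lamI_im_neg (hq : 0 < q₀) {k : ℂ} (hk : k ∈ lowerCut q₀) : (lamI q₀ k).im < 0 := by
  have hp := re_mul_im_eq_of_sq_eq (lamI_sq q₀ k)
  have him : k.im < 0 := hk.1
  rcases lt_trichotomy k.re 0 with h | h | h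
  · nlinarith [lamI_re_neg (q₀ := q₀) h, mul_pos_of_neg_of_neg h him]
  · have h1 : k.im < -q₀ := by
      by_contra! h1
      exact hk.2 ⟨h, by rw [abs_of_neg him]; linarith⟩
    -- The argument is exactly the left end of `[-π/2, 3π/2)`, which the strict inequality in
    -- `angle` leaves unshifted.
    have e1 : angle (k - Complex.I * q₀) = -(Real.pi / 2) := by
      rw [angle, arg_of_re_eq_zero_of_im_neg (by simpa using h) (by simp; linarith),
        if_neg (lt_irrefl _)]
    have e2 : angle (k + Complex.I * q₀) = -(Real.pi / 2) := by
      rw [angle, arg_of_re_eq_zero_of_im_neg (by simpa using h) (by simp; linarith),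
        if_neg (lt_irrefl _)]
    rw [lamI_im, e1, e2, add_self_div_two, Real.sin_neg, Real.sin_pi_div_two, mul_neg, mul_one,
      neg_lt_zero]
    refine sqrt_norm_mul_norm_pos (fun h2 => ?_) (fun h2 => ?_) <;>
    · have := congrArg Complex.im h2
      simp at this
      linarith
  · nlinarith [lamI_re_pos (q₀ := q₀) h, mul_neg_of_pos_of_neg h him]

theorem isClosed_cut (q₀ : ℝ) : IsClosed (cut q₀) :=
  (isClosed_eq Complex.continuous_re continuous_const).inter
    (isClosed_le Complex.continuous_im.abs continuous_const)

theorem isOpen_upperCut (q₀ : ℝ) : IsOpen (upperCut q₀) :=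
  (isOpen_lt continuous_const Complex.continuous_im).sdiff (isClosed_cut q₀)

theorem isOpen_lowerCut (q₀ : ℝ) : IsOpen (lowerCut q₀) :=
  (isOpen_lt Complex.continuous_im continuous_const).sdiff (isClosed_cut q₀)

/-- A square root with positive imaginary part must be `i` times the principal root of `-g`, whose
real part is nonnegative. Continuity of `l` need not be known beforehand. -/
theorem differentiableAt_of_sq_eq_of_im_ne_zero {g l : ℂ → ℂ} {k₀ : ℂ} {U : Set ℂ}
    (hU : U ∈ 𝓝 k₀) (hg : DifferentiableAt ℂ g k₀) (hl : ∀ k ∈ U, l k ^ 2 = g k)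
    (him : ∀ k ∈ U, 0 < (l k).im) : DifferentiableAt ℂ l k₀ := by
  have heq : ∀ k ∈ U, l k = Complex.I * (-g k) ^ ((2 : ℕ) : ℂ)⁻¹ := by
    intro k hk
    have hw := Complex.cpow_nat_inv_pow (-g k) two_ne_zero
    set w := (-g k) ^ ((2 : ℕ) : ℂ)⁻¹ with hwdef
    have hre : 0 ≤ w.re := by
      have hne : -g k ≠ 0 := by
        rw [← hl k hk, neg_ne_zero]
        refine pow_ne_zero 2 fun h => ?_
        have := him k hk
        rw [h] at this
        simp at this
      rw [hwdef, Complex.cpow_def_of_ne_zero hne, Complex.exp_re]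
      refine mul_nonneg (Real.exp_pos _).le (Real.cos_nonneg_of_mem_Icc ?_)
      have h1 := Complex.neg_pi_lt_arg (-g k)
      have h2 := Complex.arg_le_pi (-g k)
      have h3 : (Complex.log (-g k) * ((2 : ℕ) : ℂ)⁻¹).im = (-g k).arg / 2 := by
        have : (((2 : ℕ) : ℂ)⁻¹) = ((2⁻¹ : ℝ) : ℂ) := by push_cast; rfl
        rw [this, Complex.im_mul_ofReal, Complex.log_im]
        ring
      rw [h3]
      constructor <;> linarith
    have hfac : (l k - Complex.I * w) * (l k + Complex.I * w) = 0 := by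
      linear_combination hl k hk - w ^ 2 * Complex.I_sq + hw
    rcases mul_eq_zero.1 hfac with h | h
    · exact sub_eq_zero.1 h
    · have h1 := congrArg Complex.im h
      have h2 := him k hk
      simp at h1
      linarith
  -- The number `-l²` lies in `(-∞, 0]` only if `l` is real.
  have hslit : -g k₀ ∈ Complex.slitPlane := by
    have hk₀ := mem_of_mem_nhds hU
    have h := him k₀ hk₀
    rw [← hl k₀ hk₀, Complex.mem_slitPlane_iff]
    by_cases h0 : (l k₀).re = 0
    · left
      simp [sq, h0]
      positivity
    · right
      simp only [sq, Complex.neg_im, Complex.mul_im, ne_eq, neg_eq_zero]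
      have := mul_ne_zero h0 h.ne'
      intro h2
      exact this (by linarith)
  have hd : DifferentiableAt ℂ (fun k => Complex.I * (-g k) ^ ((2 : ℕ) : ℂ)⁻¹) k₀ :=
    (hg.neg.cpow_const hslit).const_mul _
  exact hd.congr_of_eventuallyEq (by filter_upwards [hU] with k hk using heq k hk)

theorem differentiableOn_lamI_upperCut (hq : 0 < q₀) :
    DifferentiableOn ℂ (lamI q₀) (upperCut q₀) := fun k hk =>
  (differentiableAt_of_sq_eq_of_im_ne_zero ((isOpen_upperCut q₀).mem_nhds hk)
    (g := fun k => k ^ 2 + (q₀ : ℂ) ^ 2) (by fun_prop) (fun k _ => lamI_sq q₀ k)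
    fun _ h => lamI_im_pos hq h).differentiableWithinAt

theorem differentiableOn_lamI_lowerCut (hq : 0 < q₀) :
    DifferentiableOn ℂ (lamI q₀) (lowerCut q₀) := fun k hk => by
  have := (differentiableAt_of_sq_eq_of_im_ne_zero ((isOpen_lowerCut q₀).mem_nhds hk)
    (g := fun k => k ^ 2 + (q₀ : ℂ) ^ 2) (l := fun k => -lamI q₀ k) (by fun_prop)
    (fun k _ => by rw [neg_sq, lamI_sq q₀ k])
    fun _ h => by simpa using lamI_im_neg hq h).neg
  simpa [Pi.neg_def] using this.differentiableWithinAt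

end Sheet

/-! ### The regions of the surface in terms of `Im k` and `Im λ` -/

section Regions

variable {q₀ : ℝ}

theorem Surface.continuous_k : Continuous (Surface.k : Surface q₀ → ℂ) :=
  continuous_fst.comp continuous_subtype_val

theorem Surface.continuous_lam : Continuous (Surface.lam : Surface q₀ → ℂ) :=
  continuous_snd.comp continuous_subtype_val

theorem Surface.lam_sq (p : Surface q₀) : p.lam ^ 2 = p.k ^ 2 + (q₀ : ℂ) ^ 2 := p.2

/-- Over the cut `λ² = q₀² - (Im k)² ≥ 0`, so `λ` is real there. -/
theorem Surface.notMem_cut_of_im_ne_zero (p : Surface q₀) (h : p.lam.im ≠ 0) : p.k ∉ cut q₀ := by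
  rintro ⟨h1, h2⟩
  have h3 := re_mul_im_eq_of_sq_eq p.lam_sq
  have h4 := re_sq_sub_im_sq_eq_of_sq_eq p.lam_sq
  rw [h1, zero_mul, mul_eq_zero, or_iff_left h] at h3
  rw [h1, h3] at h4
  have h5 := sq_le_sq' (abs_le.1 h2).1 (abs_le.1 h2).2
  have h6 : 0 < p.lam.im ^ 2 := by positivity
  linarith

theorem Surface.eq_sheetI_or (p : Surface q₀) : p.lam = lamI q₀ p.k ∨ p.lam = -lamI q₀ p.k :=
  sq_eq_sq_iff_eq_or_eq_neg.1 (p.lam_sq.trans (lamI_sq q₀ p.k).symm)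

/-- Of the two points over `k`, only the one on sheet I has `Im λ > 0`. This form makes openness and
the inclusion for the closure immediate. -/
theorem Kplus_eq (hq : 0 < q₀) : Kplus q₀ = {p | 0 < p.k.im ∧ 0 < p.lam.im} := by
  ext p
  constructor
  · rintro ⟨k, hk, rfl⟩
    exact ⟨hk.1, lamI_im_pos hq hk⟩
  · rintro ⟨h1, h2⟩
    have hk : p.k ∈ upperCut q₀ := ⟨h1, p.notMem_cut_of_im_ne_zero h2.ne'⟩
    refine ⟨p.k, hk, Subtype.ext (Prod.ext rfl ?_)⟩
    rcases p.eq_sheetI_or with h | h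
    · exact h.symm
    · have := lamI_im_pos hq hk
      rw [h, Complex.neg_im] at h2
      linarith

theorem Kminus_eq (hq : 0 < q₀) : Kminus q₀ = {p | p.k.im < 0 ∧ p.lam.im < 0} := by
  ext p
  constructor
  · rintro ⟨k, hk, rfl⟩
    exact ⟨hk.1, lamI_im_neg hq hk⟩
  · rintro ⟨h1, h2⟩
    have hk : p.k ∈ lowerCut q₀ := ⟨h1, p.notMem_cut_of_im_ne_zero h2.ne⟩
    refine ⟨p.k, hk, Subtype.ext (Prod.ext rfl ?_)⟩
    rcases p.eq_sheetI_or with h | h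
    · exact h.symm
    · have := lamI_im_neg hq hk
      rw [h, Complex.neg_im] at h2
      linarith

theorem closure_Kplus_subset (hq : 0 < q₀) :
    closure (Kplus q₀) ⊆ {p | 0 ≤ p.k.im ∧ 0 ≤ p.lam.im} := by
  refine closure_minimal ?_ ((isClosed_le continuous_const
    (Complex.continuous_im.comp Surface.continuous_k)).inter (isClosed_le continuous_const
    (Complex.continuous_im.comp Surface.continuous_lam)))
  rw [Kplus_eq hq]
  exact fun p hp => ⟨hp.1.le, hp.2.le⟩

theorem closure_Kminus_subset (hq : 0 < q₀) :
    closure (Kminus q₀) ⊆ {p | p.k.im ≤ 0 ∧ p.lam.im ≤ 0} := by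
  refine closure_minimal ?_ ((isClosed_le (Complex.continuous_im.comp Surface.continuous_k)
    continuous_const).inter (isClosed_le (Complex.continuous_im.comp Surface.continuous_lam)
    continuous_const))
  rw [Kminus_eq hq]
  exact fun p hp => ⟨hp.1.le, hp.2.le⟩

theorem isOpen_Kplus (hq : 0 < q₀) : IsOpen (Kplus q₀) := by
  rw [Kplus_eq hq]
  exact (isOpen_lt continuous_const (Complex.continuous_im.comp Surface.continuous_k)).inter
    (isOpen_lt continuous_const (Complex.continuous_im.comp Surface.continuous_lam))

theorem isOpen_Kminus (hq : 0 < q₀) : IsOpen (Kminus q₀) := by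
  rw [Kminus_eq hq]
  exact (isOpen_lt (Complex.continuous_im.comp Surface.continuous_k) continuous_const).inter
    (isOpen_lt (Complex.continuous_im.comp Surface.continuous_lam) continuous_const)

theorem Surface.lam_im_eq_zero_of_k_im_eq_zero (hq : 0 < q₀) (p : Surface q₀) (h : p.k.im = 0) :
    p.lam.im = 0 := by
  by_contra h0
  have h3 := re_mul_im_eq_of_sq_eq p.lam_sq
  have h4 := re_sq_sub_im_sq_eq_of_sq_eq p.lam_sq
  rw [h, mul_zero, mul_eq_zero, or_iff_left h0] at h3
  rw [h, h3] at h4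
  nlinarith [sq_nonneg p.k.re, sq_nonneg p.lam.im]

/-- At a boundary point one of the two weak inequalities is an equality, and real `k` already forces
real `λ`. -/
theorem lam_im_eq_zero_of_mem_frontier_Kplus (hq : 0 < q₀) {p : Surface q₀}
    (hp : p ∈ frontier (Kplus q₀)) : p.lam.im = 0 := by
  rw [frontier, (isOpen_Kplus hq).interior_eq, Kplus_eq hq] at hp
  have h1 := closure_Kplus_subset hq (Kplus_eq hq ▸ hp.1)
  by_contra h0
  refine hp.2 ⟨lt_of_le_of_ne h1.1 fun h => h0 ?_, lt_of_le_of_ne h1.2 (Ne.symm h0)⟩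
  exact p.lam_im_eq_zero_of_k_im_eq_zero hq h.symm

theorem lam_im_eq_zero_of_mem_frontier_Kminus (hq : 0 < q₀) {p : Surface q₀}
    (hp : p ∈ frontier (Kminus q₀)) : p.lam.im = 0 := by
  rw [frontier, (isOpen_Kminus hq).interior_eq, Kminus_eq hq] at hp
  have h1 := closure_Kminus_subset hq (Kminus_eq hq ▸ hp.1)
  by_contra h0
  refine hp.2 ⟨lt_of_le_of_ne h1.1 fun h => h0 ?_, lt_of_le_of_ne h1.2 h0⟩
  exact p.lam_im_eq_zero_of_k_im_eq_zero hq h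

theorem lam_im_nonneg (hq : 0 < q₀) {p : Surface q₀}
    (hp : p ∈ closure (Kplus q₀) ∪ frontier (Kminus q₀)) : 0 ≤ p.lam.im :=
  hp.elim (fun h => (closure_Kplus_subset hq h).2)
    fun h => (lam_im_eq_zero_of_mem_frontier_Kminus hq h).ge

theorem lam_im_nonpos (hq : 0 < q₀) {p : Surface q₀}
    (hp : p ∈ closure (Kminus q₀) ∪ frontier (Kplus q₀)) : p.lam.im ≤ 0 :=
  hp.elim (fun h => (closure_Kminus_subset hq h).2)
    fun h => (lam_im_eq_zero_of_mem_frontier_Kplus hq h).le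

end Regions

/-! ### From the half-line hypotheses to left half-lines `(-∞, X]` -/

section Weighted

variable {s s' : Set ℝ} {f g : ℝ → ℂ}

theorem MemL11.mono_set (h : MemL11 s f) (hs : s' ⊆ s) : MemL11 s' f :=
  ⟨h.1.mono_measure (Measure.restrict_mono hs le_rfl), h.2.mono_set hs⟩

theorem MemL11.union (h : MemL11 s f) (h' : MemL11 s' f) : MemL11 (s ∪ s') f :=
  ⟨aestronglyMeasurable_union_iff.2 ⟨h.1, h'.1⟩, h.2.union h'.2⟩

theorem MemL11.add (hf : MemL11 s f) (hg : MemL11 s g) : MemL11 s (fun x => f x + g x) := by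
  refine ⟨hf.1.add hg.1, (hf.2.add hg.2).mono' ((hf.1.add hg.1).norm.mul
    (Continuous.aestronglyMeasurable (by fun_prop))) (Eventually.of_forall fun x => ?_)⟩
  have h0 : 0 ≤ 1 + |x| := by positivity
  rw [norm_mul, norm_norm, Real.norm_eq_abs, abs_of_nonneg h0]
  simp only [Pi.add_apply]
  rw [← add_mul]
  exact mul_le_mul_of_nonneg_right (norm_add_le _ _) h0

theorem memL11_const_Icc (a b : ℝ) (c : ℂ) : MemL11 (Set.Icc a b) (fun _ => c) :=
  ⟨aestronglyMeasurable_const, Continuous.integrableOn_Icc (by fun_prop)⟩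

theorem MemL11.neg_comp_neg (hs : MeasurableSet s) (h : MemL11 s f) :
    MemL11 (Neg.neg ⁻¹' s) (fun x => -f (-x)) := by
  have hp := Measure.measurePreserving_neg (volume : Measure ℝ)
  refine ⟨(h.1.comp_measurePreserving (hp.restrict_preimage hs)).neg, ?_⟩
  have := (hp.integrableOn_comp_preimage (Homeomorph.neg ℝ).measurableEmbedding).2 h.2
  simpa [Function.comp_def] using this

/-- On `[0, X]` the two backgrounds differ by a constant, which is harmless on a bounded interval;
so `V - V₋` can be used up to any finite `X`. -/
theorem memL11_Iic_of_half_lines {c : ℂ} (hf : MemL11 (Set.Iic 0) f) (hg : MemL11 (Set.Ici 0) g)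
    (hfg : ∀ x, f x = g x + c) (X : ℝ) : MemL11 (Set.Iic X) f := by
  have h1 : MemL11 (Set.Icc 0 X) f := by
    rw [funext hfg]
    exact (hg.mono_set Set.Icc_subset_Ici_self).add (memL11_const_Icc 0 X c)
  refine (hf.union h1).mono_set fun x hx => ?_
  rcases le_total x 0 with h | h
  · exact Or.inl h
  · exact Or.inr ⟨h, hx⟩

variable {V : ℝ → Matrix (Fin 2) (Fin 2) ℂ} {Vm Vp : Matrix (Fin 2) (Fin 2) ℂ}

theorem decayingPotential_of_half_lines (hd : ∀ x i, V x i i = 0)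
    (hm : ∀ i j, MemL11 (Set.Iic 0) (fun x => (V x - Vm) i j))
    (hp : ∀ i j, MemL11 (Set.Ici 0) (fun x => (V x - Vp) i j)) : DecayingPotential V Vm where
  diag_zero := hd
  memL11 X i j := memL11_Iic_of_half_lines (c := (Vp - Vm) i j) (hm i j) (hp i j)
    (fun x => by simp) X

theorem decayingPotential_reflect_of_half_lines (hd : ∀ x i, V x i i = 0)
    (hm : ∀ i j, MemL11 (Set.Iic 0) (fun x => (V x - Vm) i j))
    (hp : ∀ i j, MemL11 (Set.Ici 0) (fun x => (V x - Vp) i j)) :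
    DecayingPotential (fun x => -V (-x)) (-Vp) := by
  refine decayingPotential_of_half_lines (Vp := -Vm) (fun x i => by simp [hd]) (fun i j => ?_)
    fun i j => ?_
  · have := (hp i j).neg_comp_neg measurableSet_Ici
    convert! this using 1
    · ext x; simp
    · funext x; simp; ring
  · have := (hm i j).neg_comp_neg measurableSet_Iic
    convert! this using 1
    · ext x; simp
    · funext x; simp; ring

end Weighted

/-! ### Algebra of the constant background -/

section Background

theorem qInf_mul_qInf {θ θ' : ℝ} (h : θ + θ' = Real.pi) (q₀ α t : ℝ) :
    qInf q₀ α θ t * qInf q₀ α θ' (-t) = -(q₀ : ℂ) ^ 2 := by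
  have : Complex.exp (Complex.I * ((α * t + θ : ℝ) : ℂ)) *
      Complex.exp (Complex.I * ((α * -t + θ' : ℝ) : ℂ)) = -1 := by
    rw [← Complex.exp_add, ← Complex.exp_pi_mul_I, ← h]
    congr 1
    push_cast
    ring
  unfold qInf
  linear_combination (q₀ : ℂ) ^ 2 * this

variable {a b k l : ℂ} {q₀ : ℝ}

/-- The matrix has trace zero, so its square is the scalar `-k² + a b = -(k² + q₀²)`. -/
theorem background_mulVec_mulVec (hab : a * b = -(q₀ : ℂ) ^ 2)
    (hl : l ^ 2 = k ^ 2 + (q₀ : ℂ) ^ 2) (v : Fin 2 → ℂ) :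
    ((Complex.I * k) • J + !![0, a; b, 0]).mulVec
      (((Complex.I * k) • J + !![0, a; b, 0]).mulVec v) = -l ^ 2 • v := by
  ext i
  fin_cases i <;> simp [J, Matrix.mulVec, dotProduct, Fin.sum_univ_two]
  · linear_combination (k ^ 2 * v 0) * Complex.I_sq + v 0 * hab + v 0 * hl
  · linear_combination (k ^ 2 * v 1) * Complex.I_sq + v 1 * hab + v 1 * hl

theorem background_mulVec_fst (hab : a * b = -(q₀ : ℂ) ^ 2)
    (hl : l ^ 2 = k ^ 2 + (q₀ : ℂ) ^ 2) :
    ((Complex.I * k) • J + !![0, a; b, 0]).mulVec ![l + k, Complex.I * b] =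
      (Complex.I * -l) • ![l + k, Complex.I * b] := by
  ext i
  fin_cases i <;> simp [J, Matrix.mulVec, dotProduct, Fin.sum_univ_two]
  · linear_combination Complex.I * hab + Complex.I * hl
  · linear_combination (k * b + l * b) * Complex.I_sq

theorem background_mulVec_snd (hab : a * b = -(q₀ : ℂ) ^ 2)
    (hl : l ^ 2 = k ^ 2 + (q₀ : ℂ) ^ 2) :
    ((Complex.I * k) • J + !![0, a; b, 0]).mulVec ![-(Complex.I * a), l + k] =
      (Complex.I * l) • ![-(Complex.I * a), l + k] := by
  ext i
  fin_cases i <;> simp [J, Matrix.mulVec, dotProduct, Fin.sum_univ_two]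
  · linear_combination (k * a + l * a) * Complex.I_sq
  · linear_combination -Complex.I * hab - Complex.I * hl

theorem IsJostPoint.of_neg {V₀ : Matrix (Fin 2) (Fin 2) ℂ} {k μ : ℂ} {c : Fin 2 → ℂ}
    (h1 : ∀ v, ((Complex.I * k) • J + V₀).mulVec (((Complex.I * k) • J + V₀).mulVec v)
      = -μ ^ 2 • v)
    (h2 : ((Complex.I * k) • J + V₀).mulVec c = (Complex.I * μ) • c) (h3 : 0 ≤ μ.im)
    (h4 : c ≠ 0) : IsJostPoint (-V₀) (-k) (-μ) c := by
  have hA : (Complex.I * -k) • J + -V₀ = -((Complex.I * k) • J + V₀) := by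
    rw [neg_add, mul_neg, neg_smul]
  refine ⟨fun v => ?_, ?_, by simpa using h3, h4⟩
  · rw [hA, Matrix.neg_mulVec, Matrix.neg_mulVec, Matrix.mulVec_neg, neg_neg, h1, neg_sq]
  · rw [hA, Matrix.neg_mulVec, h2, mul_neg, neg_smul]

theorem background_ne_zero (hq : 0 < q₀) (hab : a * b = -(q₀ : ℂ) ^ 2) : a ≠ 0 ∧ b ≠ 0 := by
  rw [← mul_ne_zero_iff, hab, neg_ne_zero]
  exact pow_ne_zero 2 (Complex.ofReal_ne_zero.2 hq.ne')

theorem vec_fst_ne_zero (hq : 0 < q₀) (hab : a * b = -(q₀ : ℂ) ^ 2) (z : ℂ) :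
    ![z, Complex.I * b] ≠ 0 := fun h =>
  mul_ne_zero Complex.I_ne_zero (background_ne_zero hq hab).2 (by simpa using congrFun h 1)

theorem vec_snd_ne_zero (hq : 0 < q₀) (hab : a * b = -(q₀ : ℂ) ^ 2) (z : ℂ) :
    ![-(Complex.I * a), z] ≠ 0 := fun h =>
  mul_ne_zero Complex.I_ne_zero (background_ne_zero hq hab).1 (by simpa using congrFun h 0)

end Background

/-! ### Jost functions over a set of points of the surface -/

section SurfaceFamilies

theorem continuous_vec_pair {Λ : Type*} [TopologicalSpace Λ] {f g : Λ → ℂ} (hf : Continuous f)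
    (hg : Continuous g) : Continuous (fun p => ![f p, g p]) :=
  continuous_pi (Fin.forall_fin_two.2 ⟨by simpa using hf, by simpa using hg⟩)

theorem differentiableOn_vec_pair {f g : ℂ → ℂ} {U : Set ℂ} (hf : DifferentiableOn ℂ f U)
    (hg : DifferentiableOn ℂ g U) : DifferentiableOn ℂ (fun z => ![f z, g z]) U :=
  differentiableOn_pi.2 (Fin.forall_fin_two.2 ⟨by simpa using hf, by simpa using hg⟩)

variable {V : ℝ → Matrix (Fin 2) (Fin 2) ℂ} {V₀ : Matrix (Fin 2) (Fin 2) ℂ} {q₀ : ℝ}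
  {k μ : Surface q₀ → ℂ} {c : Surface q₀ → Fin 2 → ℂ} {S : Set (Surface q₀)} {U : Set ℂ}

theorem jost_atBot_on_surface (hV : DecayingPotential V V₀)
    (hk : Continuous k) (hμ : Continuous μ) (hc : Continuous c)
    (hp : ∀ p ∈ S, IsJostPoint V₀ (k p) (μ p) (c p)) (hU : IsOpen U)
    (hUS : ∀ z ∈ U, sheetI q₀ z ∈ S) (hkU : DifferentiableOn ℂ (fun z => k (sheetI q₀ z)) U)
    (hμU : DifferentiableOn ℂ (fun z => μ (sheetI q₀ z)) U)
    (hcU : DifferentiableOn ℂ (fun z => c (sheetI q₀ z)) U) :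
    (∀ p ∈ S, ∃! v, IsJost V (k p) (μ p) atBot (c p) v) ∧
    ∀ x, ContinuousOn (fun p => jostFun V atBot (k p) (μ p) (c p) x) S ∧
      AnalyticOnNhd ℂ (fun z => jostFun V atBot (k (sheetI q₀ z)) (μ (sheetI q₀ z))
        (c (sheetI q₀ z)) x) U :=
  ⟨fun p h => existsUnique_isJost_atBot hV (hp p h), fun x =>
    ⟨continuousOn_jostFun_atBot hV hk.continuousOn hμ.continuousOn hc.continuousOn hp x,
      analyticOnNhd_jostFun_atBot (k := fun z => k (sheetI q₀ z)) (μ := fun z => μ (sheetI q₀ z))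
        (c := fun z => c (sheetI q₀ z)) hV hU hkU hμU hcU (fun z hz => hp _ (hUS z hz)) x⟩⟩

theorem jost_atTop_on_surface (hV : DecayingPotential (fun x => -V (-x)) (-V₀))
    (hk : Continuous k) (hμ : Continuous μ) (hc : Continuous c)
    (hp : ∀ p ∈ S, IsJostPoint (-V₀) (-k p) (-μ p) (c p)) (hU : IsOpen U)
    (hUS : ∀ z ∈ U, sheetI q₀ z ∈ S) (hkU : DifferentiableOn ℂ (fun z => k (sheetI q₀ z)) U)
    (hμU : DifferentiableOn ℂ (fun z => μ (sheetI q₀ z)) U)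
    (hcU : DifferentiableOn ℂ (fun z => c (sheetI q₀ z)) U) :
    (∀ p ∈ S, ∃! v, IsJost V (k p) (μ p) atTop (c p) v) ∧
    ∀ x, ContinuousOn (fun p => jostFun V atTop (k p) (μ p) (c p) x) S ∧
      AnalyticOnNhd ℂ (fun z => jostFun V atTop (k (sheetI q₀ z)) (μ (sheetI q₀ z))
        (c (sheetI q₀ z)) x) U := by
  obtain ⟨-, h⟩ := jost_atBot_on_surface hV hk.neg hμ.neg hc hp hU hUS hkU.fun_neg hμU.fun_neg hcU
  exact ⟨fun p h => existsUnique_isJost_atTop hV (hp p h), fun x =>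
    ⟨(h (-x)).1.congr fun p hpS => jostFun_atTop_eq hV (hp p hpS) x,
      (h (-x)).2.congr hU fun z hz => (jostFun_atTop_eq hV (hp _ (hUS z hz)) x).symm⟩⟩

end SurfaceFamilies

/-! ### The functions of the theorem as Jost functions -/

section Normalised

variable (q₀ α θp θm : ℝ) (q : ℝ → ℝ → ℂ) (t : ℝ) (p : Surface q₀) (x : ℝ)

theorem M_eq_jostFun : M q₀ α θp q t p x = jostFun (Q q t) atBot p.k (-p.lam)
    ![p.lam + p.k, Complex.I * qInf q₀ α θp (-t)] x := by
  rw [M, jostFun, mul_neg, neg_mul, neg_neg]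
  rfl

theorem MBar_eq_jostFun : MBar q₀ α θm q t p x = jostFun (Q q t) atBot p.k p.lam
    ![-(Complex.I * qInf q₀ α θm t), p.lam + p.k] x := rfl

theorem N_eq_jostFun : N q₀ α θp q t p x = jostFun (Q q t) atTop p.k p.lam
    ![-(Complex.I * qInf q₀ α θp t), p.lam + p.k] x := rfl

theorem NBar_eq_jostFun : NBar q₀ α θm q t p x = jostFun (Q q t) atTop p.k (-p.lam)
    ![p.lam + p.k, Complex.I * qInf q₀ α θm (-t)] x := by
  rw [NBar, jostFun, mul_neg, neg_mul, neg_neg]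
  rfl

end Normalised

end NonlocalSinhGordon

theorem mainTheorem3 (q₀ α θp θm : ℝ) (hq₀ : 0 < q₀) (hθ : θp + θm = Real.pi)
    (q : ℝ → ℝ → ℂ) (t : ℝ)
    (hplus : ∀ i j, MemL11 (Set.Ici 0)
      (fun x => (NonlocalSinhGordon.Q q t x - Qplus q₀ α θp θm t) i j))
    (hminus : ∀ i j, MemL11 (Set.Iic 0)
      (fun x => (NonlocalSinhGordon.Q q t x - Qminus q₀ α θp θm t) i j)) :
    -- the eigenfunctions are well defined on the respective sets
    (∀ p ∈ closure (Kplus q₀) ∪ frontier (Kminus q₀),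
      (∃! φ, IsPhi q₀ α θp q t p φ) ∧ (∃! ψ, IsPsi q₀ α θp q t p ψ)) ∧
    (∀ p ∈ closure (Kminus q₀) ∪ frontier (Kplus q₀),
      (∃! φ, IsPhiBar q₀ α θm q t p φ) ∧ (∃! ψ, IsPsiBar q₀ α θm q t p ψ)) ∧
    ∀ x : ℝ,
      (ContinuousOn (fun p => NonlocalSinhGordon.M q₀ α θp q t p x)
          (closure (Kplus q₀) ∪ frontier (Kminus q₀)) ∧
        AnalyticOnNhd ℂ (fun k => NonlocalSinhGordon.M q₀ α θp q t (sheetI q₀ k) x)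
          (upperCut q₀)) ∧
      (ContinuousOn (fun p => NonlocalSinhGordon.N q₀ α θp q t p x)
          (closure (Kplus q₀) ∪ frontier (Kminus q₀)) ∧
        AnalyticOnNhd ℂ (fun k => NonlocalSinhGordon.N q₀ α θp q t (sheetI q₀ k) x)
          (upperCut q₀)) ∧
      (ContinuousOn (fun p => MBar q₀ α θm q t p x)
          (closure (Kminus q₀) ∪ frontier (Kplus q₀)) ∧
        AnalyticOnNhd ℂ (fun k => MBar q₀ α θm q t (sheetI q₀ k) x) (lowerCut q₀)) ∧
      (ContinuousOn (fun p => NBar q₀ α θm q t p x)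
          (closure (Kminus q₀) ∪ frontier (Kplus q₀)) ∧
        AnalyticOnNhd ℂ (fun k => NBar q₀ α θm q t (sheetI q₀ k) x) (lowerCut q₀)) := by
  have hkc := Surface.continuous_k (q₀ := q₀)
  have hlc := Surface.continuous_lam (q₀ := q₀)
  have hd : ∀ x i, NonlocalSinhGordon.Q q t x i i = 0 := fun x i => by
    fin_cases i <;> simp [NonlocalSinhGordon.Q]
  have hVm := decayingPotential_of_half_lines hd hminus hplus
  have hVp := decayingPotential_reflect_of_half_lines hd hminus hplus
  have hm : qInf q₀ α θm t * qInf q₀ α θp (-t) = -(q₀ : ℂ) ^ 2 :=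
    qInf_mul_qInf (by rw [add_comm, hθ]) q₀ α t
  have hp : qInf q₀ α θp t * qInf q₀ α θm (-t) = -(q₀ : ℂ) ^ 2 := qInf_mul_qInf hθ q₀ α t
  have hUp : ∀ z ∈ upperCut q₀, sheetI q₀ z ∈ closure (Kplus q₀) ∪ frontier (Kminus q₀) :=
    fun z hz => Or.inl (subset_closure ⟨z, hz, rfl⟩)
  have hUm : ∀ z ∈ lowerCut q₀, sheetI q₀ z ∈ closure (Kminus q₀) ∪ frontier (Kplus q₀) :=
    fun z hz => Or.inl (subset_closure ⟨z, hz, rfl⟩)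
  have hdp := differentiableOn_lamI_upperCut hq₀
  have hdm := differentiableOn_lamI_lowerCut hq₀
  -- Here `μ = -λ`, so the requirement `Im μ ≤ 0` at `-∞` reads `Im λ ≥ 0`. For `ψ` the reflection
  -- changes `μ = λ` into `-λ`, with the same requirement; the barred functions need `Im λ ≤ 0`.
  obtain ⟨phi, hM⟩ := jost_atBot_on_surface hVm hkc hlc.neg
    (continuous_vec_pair (hlc.add hkc) continuous_const)
    (fun p hpS => ⟨background_mulVec_mulVec hm ((neg_sq _).trans p.lam_sq),
      background_mulVec_fst hm p.lam_sq, by simpa using lam_im_nonneg hq₀ hpS,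
      vec_fst_ne_zero hq₀ hm _⟩)
    (isOpen_upperCut q₀) hUp differentiableOn_id hdp.fun_neg
    (differentiableOn_vec_pair (hdp.fun_add differentiableOn_id) (differentiableOn_const _))
  obtain ⟨psi, hN⟩ := jost_atTop_on_surface hVp hkc hlc
    (continuous_vec_pair continuous_const (hlc.add hkc))
    (fun p hpS => IsJostPoint.of_neg (background_mulVec_mulVec hp p.lam_sq)
      (background_mulVec_snd hp p.lam_sq) (lam_im_nonneg hq₀ hpS) (vec_snd_ne_zero hq₀ hp _))
    (isOpen_upperCut q₀) hUp differentiableOn_id hdp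
    (differentiableOn_vec_pair (differentiableOn_const _) (hdp.fun_add differentiableOn_id))
  obtain ⟨phiBar, hMBar⟩ := jost_atBot_on_surface hVm hkc hlc
    (continuous_vec_pair continuous_const (hlc.add hkc))
    (fun p hpS => ⟨background_mulVec_mulVec hm p.lam_sq, background_mulVec_snd hm p.lam_sq,
      lam_im_nonpos hq₀ hpS, vec_snd_ne_zero hq₀ hm _⟩)
    (isOpen_lowerCut q₀) hUm differentiableOn_id hdm
    (differentiableOn_vec_pair (differentiableOn_const _) (hdm.fun_add differentiableOn_id))
  obtain ⟨psiBar, hNBar⟩ := jost_atTop_on_surface hVp hkc hlc.neg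
    (continuous_vec_pair (hlc.add hkc) continuous_const)
    (fun p hpS => IsJostPoint.of_neg (background_mulVec_mulVec hp ((neg_sq _).trans p.lam_sq))
      (background_mulVec_fst hp p.lam_sq) (by simpa using lam_im_nonpos hq₀ hpS)
      (vec_fst_ne_zero hq₀ hp _))
    (isOpen_lowerCut q₀) hUm differentiableOn_id hdm.fun_neg
    (differentiableOn_vec_pair (hdm.fun_add differentiableOn_id) (differentiableOn_const _))
  refine ⟨fun p h => ⟨phi p h, psi p h⟩, fun p h => ⟨phiBar p h, psiBar p h⟩, fun x => ?_⟩
  simp only [M_eq_jostFun, MBar_eq_jostFun, N_eq_jostFun, NBar_eq_jostFun]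
  exact ⟨hM x, hN x, hMBar x, hNBar x⟩
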